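/- Theorem 1.1. Let $M$ be a closed (compact, without boundary) connected 3-manifold with a (simplicial) triangulation $\mathcal T$, with vertex set $V$, $|V|=N$, and set of tetrahedra $\mathcal T_3$. Let $\mathcal M_{\mathcal T}\subset\mathbb R_{>0}^N$ be the set of (real) ball packings, i.e. of all $r=(r_i)_{i\in V}$ with $r_i>0$ such that for every $\{ijkl\}\in\mathcal T_3$ there is a nondegenerate Euclidean tetrahedron whose edge between the vertices $a,b\in\{i,j,k,l\}$ has length $r_a+r_b$. For $r\in\mathcal M_{\mathcal T}$ let $\alpha_{ijkl}$ be the solid angle at the vertex $i$ of that tetrahedron, let $$K_i=4\pi-\sum_{\{ijkl\}\in\mathcal T_3}\alpha_{ijkl}$$ (sum over the tetrahedra that have $i$ as a vertex) be the Cooper–Rivin combinatorial scalar curvature at $i$, and let $$\lambda(r)=\frac{\sum_{i\in V}K_ir_i}{\sum_{i\in V}r_i},\qquad Y_{\mathcal T}=\inf_{r\in\mathcal M_{\mathcal T}}\lambda(r)$$ be the Cooper–Rivin–Glickenstein functional and the combinatorial Yamabe invariant. The set $\mathcal M_{\mathcal T}$ is nonempty and $Y_{\mathcal T}$ is finite.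 The following are equivalent: 1. there is $r\in\mathcal M_{\mathcal T}$ with constant curvature, i.e. $K_i(r)=K_j(r)$ for all $i,j\in V$; 2. $Y_{\mathcal T}$ is attained, i.e. $\lambda(r)=Y_{\mathcal T}$ for some $r\in\mathcal M_{\mathcal T}$; equivalently, $\lambda$ has a global minimum in $\mathcal M_{\mathcal T}$; 3. $\lambda$ has a local minimum in $\mathcal M_{\mathcal T}$; 4. $\lambda$ has a critical point in $\mathcal M_{\mathcal T}$. Moreover, if $\hat r\in\mathcal M_{\mathcal T}$ has constant curvature, then $\lambda(\hat r)=Y_{\mathcal T}$, and the global minimum points of $\lambda$ in $\mathcal M_{\mathcal T}$ are exactly the packings $c\hat r$ with $c>0$; in particular, the constant curvature packing is unique up to scaling. -/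

import Mathlib

noncomputable section

/-- Euclidean three-space. -/
abbrev E3 : Type := EuclideanSpace ℝ (Fin 3)

/-- The geometric realization of the simplicial complex on the vertex set `V` whose simplices are
the nonempty subsets of the members of `tets`: a point is given by its barycentric coordinates,
and these are supported in one of the members of `tets`. -/
def geomRealization {V : Type*} [Fintype V] (tets : Finset (Finset V)) : Set (V → ℝ) :=
  {x | (∀ v, 0 ≤ x v) ∧ ∑ v, x v = 1 ∧ ∃ τ ∈ tets, ∀ v, v ∉ τ → x v = 0}

/-- A triangulation of the space `M`, i.e. a decomposition of `M` into tetrahedra in the sense of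
simplicial complexes: a finite vertex set `V`, a set of tetrahedra (four-element sets of vertices;
edges and triangles are the faces of the tetrahedra) in which every vertex occurs, and a
homeomorphism from the geometric realization onto `M`. -/
structure Triangulation (M : Type*) [TopologicalSpace M] (V : Type*) [Fintype V] where
  /-- the tetrahedra -/
  tets : Finset (Finset V)
  card_tet : ∀ τ ∈ tets, τ.card = 4
  exists_tet : ∀ v : V, ∃ τ ∈ tets, v ∈ τ
  /-- the identification of the geometric realization with `M` -/
  homeo : geomRealization tets ≃ₜ M

section Tetrahedron

variable {V : Type*}

/-- The points `p j`, `j ∈ τ`, are the vertices of a nondegenerate Euclidean simplex in which the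
edge between the vertices `j` and `k` has length `r j + r k`. -/
def IsRealization (τ : Finset V) (r : V → ℝ) (p : V → E3) : Prop :=
  AffineIndependent ℝ (fun j : τ => p j) ∧
    ∀ j ∈ τ, ∀ k ∈ τ, j ≠ k → dist (p j) (p k) = r j + r k

/-- The infinite cone (translated to the origin) spanned at the vertex `p i` by the simplex with
vertices `p j`, `j ∈ τ`. -/
def vertexCone (τ : Finset V) (p : V → E3) (i : V) : Set E3 :=
  {x | ∃ c : V → ℝ, (∀ j, 0 ≤ c j) ∧ x = ∑ j ∈ τ, c j • (p j - p i)}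

/-- The solid angle at the vertex `p i` of the simplex with vertices `p j`, `j ∈ τ`: the area of
the part of the unit sphere that lies in the cone spanned at `p i`. -/
def solidAngleAt (τ : Finset V) (p : V → E3) (i : V) : ℝ :=
  (MeasureTheory.volume : MeasureTheory.Measure E3).toSphere.real
    {u : Metric.sphere (0 : E3) 1 | (u : E3) ∈ vertexCone τ p i}

open Classical in
/-- The solid angle at the vertex `i` of the Euclidean tetrahedron `τ` with edge lengths
`r j + r k`. That tetrahedron is unique up to isometry, so any realization can be used; the value
`0` is assigned if there is none. -/
def solidAngle (τ : Finset V) (r : V → ℝ) (i : V) : ℝ :=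
  if h : ∃ p : V → E3, IsRealization τ r p then solidAngleAt τ h.choose i else 0

end Tetrahedron

namespace Triangulation

variable {M : Type*} [TopologicalSpace M] {V : Type*} [Fintype V]

/-- The space of (real) ball packings: positive radii such that each tetrahedron of the
triangulation, with edge lengths `r j + r k`, is realized by a nondegenerate Euclidean
tetrahedron. -/
def ballPackings (T : Triangulation M V) : Set (V → ℝ) :=
  {r | (∀ i, 0 < r i) ∧ ∀ τ ∈ T.tets, ∃ p : V → E3, IsRealization τ r p}

open Classical in
/-- The combinatorial scalar curvature of Cooper and Rivin at the vertex `i`. -/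
def curvature (T : Triangulation M V) (r : V → ℝ) (i : V) : ℝ :=
  4 * Real.pi - ∑ τ ∈ T.tets with i ∈ τ, solidAngle τ r i

/-- The packing `r` has constant combinatorial scalar curvature. -/
def HasConstantCurvature (T : Triangulation M V) (r : V → ℝ) : Prop :=
  ∃ c : ℝ, ∀ i, T.curvature r i = c

/-- The Cooper–Rivin–Glickenstein functional. It is meant for `r ∈ T.ballPackings`. -/
def crg (T : Triangulation M V) (r : V → ℝ) : ℝ :=
  (∑ i, T.curvature r i * r i) / ∑ i, r i

/-- The combinatorial Yamabe invariant. -/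
def yamabeInvariant (T : Triangulation M V) : ℝ :=
  sInf (T.crg '' T.ballPackings)

end Triangulation

end

/-!
Four mutually tangent balls span a nondegenerate tetrahedron exactly when the quadratic form of
Descartes' circle theorem is positive at their inverse radii, and by Girard's theorem the solid
angles are then sums of arctangents in the inverse radii. The Jacobian of the solid angles with
respect to the radii is symmetric, kills the radii (the Schläfli formula) and is negative
semidefinite, because its kernel has constant dimension on a connected domain and it is a negative
multiple of a graph Laplacian at equal radii.

The domain of realizable radii is not convex. However, the solid angles extend continuously, with
locally constant values, through the degenerate quadruples, so they are monotone along segments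
between any two positive quadruples. Summing over the tetrahedra gives
`⟪K(r') - K(r), r' - r⟫ ≥ 0`, where equality forces `r'` to be proportional to `r` on each
tetrahedron.

By the Schläfli formula, the gradient of `λ` is `(K - λ) / ∑ rᵢ`, so the critical points are the
packings of constant curvature. If `r` is one of these, monotonicity between `r'` and `s • r`
becomes `λ(r') ≥ λ(r)` as `s → 0`; all minimum points have the same curvature, so connectedness of
the manifold makes them proportional.
-/

noncomputable section

open Set Filter Topology MeasureTheory Module Matrix

section PosDef

variable {n : Type*}

lemma isClosed_setOf_posSemidef [Finite n] : IsClosed {A : Matrix n n ℝ | A.PosSemidef} := by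
  cases nonempty_fintype n
  simp only [posSemidef_iff_dotProduct_mulVec, IsHermitian, ofPred_and, ofPred_forall]
  exact (isClosed_eq (by fun_prop) continuous_id).inter
    (isClosed_iInter fun z => isClosed_le continuous_const (by fun_prop))

lemma posDef_of_forall_mem_sphere [Fintype n] {A : Matrix n n ℝ} (hA : A.IsHermitian)
    (h : ∀ z ∈ Metric.sphere (0 : n → ℝ) 1, 0 < z ⬝ᵥ A *ᵥ z) : A.PosDef := by
  refine .of_dotProduct_mulVec_pos hA fun z hz => ?_
  have hz' : 0 < ‖z‖ := norm_pos_iff.mpr hz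
  have := h (‖z‖⁻¹ • z) (by simp [norm_smul, hz'.ne'])
  rw [mulVec_smul, smul_dotProduct, dotProduct_smul, smul_smul, smul_eq_mul] at this
  exact pos_of_mul_pos_right this (by positivity)

lemma eventually_posDef_of_continuous [Finite n] {X : Type*} [TopologicalSpace X]
    {A : X → Matrix n n ℝ} (hA : Continuous A) (hH : ∀ x, (A x).IsHermitian) {x : X}
    (hx : (A x).PosDef) : ∀ᶠ y in 𝓝 x, (A y).PosDef := by
  cases nonempty_fintype n
  have hform : Continuous fun p : X × (n → ℝ) => p.2 ⬝ᵥ A p.1 *ᵥ p.2 := by fun_prop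
  have hpos : ∀ z ∈ Metric.sphere (0 : n → ℝ) 1,
      ∀ᶠ p : X × (n → ℝ) in 𝓝 (x, z), 0 < p.2 ⬝ᵥ A p.1 *ᵥ p.2 := fun z hz =>
    hform.continuousAt.eventually_const_lt
      (hx.dotProduct_mulVec_pos (ne_zero_of_mem_unit_sphere ⟨z, hz⟩))
  filter_upwards [(isCompact_sphere _ _).eventually_forall_of_forall_eventually
    (P := fun y z => 0 < z ⬝ᵥ A y *ᵥ z) hpos] with y hy
  exact posDef_of_forall_mem_sphere (hH y) hy

variable [Fintype n]

lemma dotProduct_mulVec_eq_zero_of_isSymm {A : Matrix n n ℝ} (hA : A.IsSymm) {k : n → ℝ}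
    (hAk : A *ᵥ k = 0) (z : n → ℝ) : k ⬝ᵥ A *ᵥ z = 0 := by
  rw [dotProduct_mulVec, ← mulVec_transpose, hA.eq, hAk, zero_dotProduct]

lemma add_vecMulVec_mulVec (A : Matrix n n ℝ) (k z : n → ℝ) :
    (A + vecMulVec k k) *ᵥ z = A *ᵥ z + (k ⬝ᵥ z) • k := by
  rw [add_mulVec, vecMulVec_mulVec, op_smul_eq_smul]

lemma posSemidef_of_posDef_add_vecMulVec {A : Matrix n n ℝ} (hA : A.IsSymm) {k : n → ℝ}
    (hAk : A *ᵥ k = 0) (hk : k ≠ 0) (h : (A + vecMulVec k k).PosDef) : A.PosSemidef := by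
  refine .of_dotProduct_mulVec_nonneg hA fun z => ?_
  -- `A` sees only the component of `z` orthogonal to `k`, where the two forms agree
  set y := z - (k ⬝ᵥ z / k ⬝ᵥ k) • k
  have horth : k ⬝ᵥ y = 0 := by
    rw [dotProduct_sub, dotProduct_smul, smul_eq_mul,
      div_mul_cancel₀ _ (dotProduct_self_eq_zero.not.mpr hk), sub_self]
  have hAy : A *ᵥ y = A *ᵥ z := by rw [mulVec_sub, mulVec_smul, hAk, smul_zero, sub_zero]
  have hform := h.posSemidef.dotProduct_mulVec_nonneg y
  rwa [add_vecMulVec_mulVec, horth, zero_smul, add_zero, hAy, star_trivial, sub_dotProduct,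
    smul_dotProduct, dotProduct_mulVec_eq_zero_of_isSymm hA hAk, smul_zero, sub_zero] at hform

theorem posDef_of_preconnectedSpace [DecidableEq n] {X : Type*} [TopologicalSpace X]
    [PreconnectedSpace X] {A : X → Matrix n n ℝ} (hA : Continuous A) (hH : ∀ x, (A x).IsHermitian)
    (hunit : ∀ x, IsUnit (A x)) {x₀ : X} (h₀ : (A x₀).PosDef) (x : X) : (A x).PosDef := by
  have hclosed : IsClosed {x | (A x).PosDef} := by
    have heq : {x | (A x).PosDef} = A ⁻¹' {B | B.PosSemidef} :=
      Set.ext fun x => ⟨PosDef.posSemidef, fun h => h.posDef_iff_isUnit.mpr (hunit x)⟩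
    exact heq ▸ isClosed_setOf_posSemidef.preimage hA
  have hopen : IsOpen {x | (A x).PosDef} :=
    isOpen_iff_mem_nhds.mpr fun x hx => eventually_posDef_of_continuous hA hH hx
  have huniv := IsClopen.eq_univ ⟨hclosed, hopen⟩ ⟨x₀, h₀⟩
  exact huniv.ge (mem_univ x)

lemma isUnit_add_vecMulVec [DecidableEq n] {A : Matrix n n ℝ} (hA : A.IsSymm) {k : n → ℝ}
    (hAk : A *ᵥ k = 0) (hk : k ≠ 0) (hker : ∀ z, A *ᵥ z = 0 → ∃ c : ℝ, z = c • k) :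
    IsUnit (A + vecMulVec k k) := by
  rw [← mulVec_injective_iff_isUnit, ← coe_mulVecLin, injective_iff_map_eq_zero]
  intro z hz
  rw [mulVecLin_apply, add_vecMulVec_mulVec] at hz
  have hkk : k ⬝ᵥ k ≠ 0 := dotProduct_self_eq_zero.not.mpr hk
  have horth : k ⬝ᵥ z = 0 := by
    have hdot := congrArg (k ⬝ᵥ ·) hz
    simp only [dotProduct_add, dotProduct_mulVec_eq_zero_of_isSymm hA hAk, zero_add,
      dotProduct_smul, smul_eq_mul, dotProduct_zero] at hdot
    exact (mul_eq_zero.mp hdot).resolve_right hkk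
  rw [horth, zero_smul, add_zero] at hz
  obtain ⟨c, rfl⟩ := hker z hz
  rw [dotProduct_smul, smul_eq_mul] at horth
  rw [(mul_eq_zero.mp horth).resolve_right hkk, zero_smul]

theorem posSemidef_of_preconnectedSpace {X : Type*} [TopologicalSpace X] [PreconnectedSpace X]
    {A : X → Matrix n n ℝ} {k : X → n → ℝ} (hA : Continuous A) (hk : Continuous k)
    (hsymm : ∀ x, (A x).IsSymm) (hAk : ∀ x, A x *ᵥ k x = 0) (hk₀ : ∀ x, k x ≠ 0)
    (hker : ∀ x z, A x *ᵥ z = 0 → ∃ c : ℝ, z = c • k x) {x₀ : X} (h₀ : (A x₀).PosSemidef) (x : X) :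
    (A x).PosSemidef := by
  classical
  have hunit : ∀ x, IsUnit (A x + vecMulVec (k x) (k x)) := fun x =>
    isUnit_add_vecMulVec (hsymm x) (hAk x) (hk₀ x) (hker x)
  have hrank : ∀ x, (vecMulVec (k x) (k x)).PosSemidef := fun x => by
    simpa only [star_trivial] using posSemidef_vecMulVec_self_star (k x)
  have hbase : (A x₀ + vecMulVec (k x₀) (k x₀)).PosDef :=
    (h₀.add (hrank x₀)).posDef_iff_isUnit.mpr (hunit x₀)
  exact posSemidef_of_posDef_add_vecMulVec (hsymm x) (hAk x) (hk₀ x)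
    (posDef_of_preconnectedSpace (by fun_prop)
      (fun x => IsHermitian.add (hsymm x) (hrank x).isHermitian) hunit hbase x)

end PosDef

section Descartes

variable {k : Fin 4 → ℝ}

/-- The sum of the four numbers `k i`, with the sign of `k j` reversed: half of the `j`-th partial
derivative of `descartes`. If the `k i` are the inverse radii of four mutually tangent balls, then
`faceSum k j / √(descartes k)` is the tangent of `faceAngle k j`. -/
def faceSum (k : Fin 4 → ℝ) (j : Fin 4) : ℝ := ∑ i, k i - 2 * k j

/-- The quadratic form of Descartes' circle theorem. Four mutually tangent balls with inverse radii
`k i` span a nondegenerate tetrahedron if and only if it is positive at `k`. -/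
def descartes (k : Fin 4 → ℝ) : ℝ := (∑ i, k i) ^ 2 - 2 * ∑ i, k i ^ 2

lemma descartes_smul (c : ℝ) (k : Fin 4 → ℝ) : descartes (c • k) = c ^ 2 * descartes k := by
  simp only [descartes, Fin.sum_univ_four, Pi.smul_apply, smul_eq_mul]
  ring

lemma faceSum_smul (c : ℝ) (k : Fin 4 → ℝ) (j : Fin 4) : faceSum (c • k) j = c * faceSum k j := by
  simp only [faceSum, Fin.sum_univ_four, Pi.smul_apply, smul_eq_mul]
  ring

lemma sum_faceSum_mul_self (k : Fin 4 → ℝ) : ∑ j, faceSum k j * k j = descartes k := by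
  simp only [descartes, faceSum, Fin.sum_univ_four]
  ring

lemma descartes_add_faceSum_sq_pos (hk : ∀ i, 0 < k i) (j : Fin 4) :
    0 < descartes k + faceSum k j ^ 2 := by
  have hprod : ∀ i l, 0 < k i * k l := fun i l => mul_pos (hk i) (hk l)
  simp only [descartes, faceSum, Fin.sum_univ_four]
  fin_cases j <;> simp only [Fin.zero_eta, Fin.mk_one, Fin.reduceFinMk]
  · linarith [hprod 1 2, hprod 1 3, hprod 2 3]
  · linarith [hprod 0 2, hprod 0 3, hprod 2 3]
  · linarith [hprod 0 1, hprod 0 3, hprod 1 3]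
  · linarith [hprod 0 1, hprod 0 2, hprod 1 2]

/-- The Jacobian matrix of the face angles with respect to the inverse radii `k`, multiplied by
`√(descartes k)`. -/
def faceAngleMatrix (k : Fin 4 → ℝ) : Matrix (Fin 4) (Fin 4) ℝ :=
  of fun j m => (descartes k * (if j = m then -1 else 1) - faceSum k j * faceSum k m) /
    (descartes k + faceSum k j ^ 2)

/-- The Jacobian matrix of the solid angles with respect to the radii `k⁻¹`, up to the factor
`-2 / √(descartes k)`. -/
def angleMatrix (k : Fin 4 → ℝ) : Matrix (Fin 4) (Fin 4) ℝ :=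
  of fun i m => (∑ j, faceAngleMatrix k j m - faceAngleMatrix k i m) * k m ^ 2

lemma exists_compl_pair_eq_pair {i m : Fin 4} (him : i ≠ m) :
    ∃ j l, j ≠ l ∧ ({i, m}ᶜ : Finset (Fin 4)) = {j, l} := by
  decide +revert

lemma angleMatrix_apply_of_ne (hk : ∀ i, 0 < k i) {i m : Fin 4} (him : i ≠ m) :
    angleMatrix k i m = -(8 * (k i * k m) ^ 2 *
      (descartes k + 2 * (k i ^ 2 + k i * k m + k m ^ 2) - (∑ j, k j) * (k i + k m)) /
        ∏ j ∈ {i, m}ᶜ, (descartes k + faceSum k j ^ 2)) := by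
  obtain ⟨j, l, hjl, hcompl⟩ := exists_compl_pair_eq_pair him
  have hsum : ∀ f : Fin 4 → ℝ, ∑ x, f x = f i + f m + (f j + f l) := fun f => by
    rw [← Finset.sum_add_sum_compl {i, m}, hcompl, Finset.sum_pair him, Finset.sum_pair hjl]
  have hne : j ≠ m ∧ l ≠ m := by
    have : ∀ x ∈ ({j, l} : Finset (Fin 4)), x ≠ m := hcompl ▸ by simp
    simpa using this
  have hE : ∀ x, descartes k + faceSum k x ^ 2 ≠ 0 := fun x =>
    (descartes_add_faceSum_sq_pos hk x).ne'
  have hdiag : faceAngleMatrix k m m = -1 := by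
    rw [faceAngleMatrix, of_apply, if_pos rfl, div_eq_iff (hE m)]
    ring
  have hi := (hk i)
  have hm := (hk m)
  have hj := (hk j)
  have hl := (hk l)
  have hEj : descartes k + faceSum k j ^ 2 = 4 * (k i * k m + k i * k l + k m * k l) := by
    simp only [descartes, faceSum, hsum]; ring
  have hEl : descartes k + faceSum k l ^ 2 = 4 * (k i * k m + k i * k j + k m * k j) := by
    simp only [descartes, faceSum, hsum]; ring
  rw [hcompl, Finset.prod_pair hjl, angleMatrix, of_apply, hsum, hdiag, add_sub_assoc]
  simp only [faceAngleMatrix, of_apply, if_neg hne.1, if_neg hne.2, hEj, hEl]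
  field_simp
  simp only [descartes, faceSum, hsum]
  ring

lemma isSymm_angleMatrix (hk : ∀ i, 0 < k i) : (angleMatrix k).IsSymm := by
  refine IsSymm.ext fun i m => ?_
  rcases eq_or_ne i m with rfl | him
  · rfl
  · rw [angleMatrix_apply_of_ne hk him, angleMatrix_apply_of_ne hk him.symm, Finset.pair_comm]
    ring_nf

lemma faceAngleMatrix_mulVec_apply (k z : Fin 4 → ℝ) (j : Fin 4) :
    (faceAngleMatrix k *ᵥ z) j =
      (descartes k * faceSum z j - faceSum k j * ∑ m, faceSum k m * z m) /
        (descartes k + faceSum k j ^ 2) := by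
  have hrefl : faceSum z j = ∑ m, (if j = m then -1 else 1) * z m := by
    have hterm : ∀ m, (if j = m then -1 else 1) * z m = z m - if j = m then 2 * z m else 0 :=
      fun m => by split_ifs <;> ring
    simp only [hterm, Finset.sum_sub_distrib, Finset.sum_ite_eq, Finset.mem_univ, if_true, faceSum]
  simp only [hrefl, Finset.mul_sum, ← Finset.sum_sub_distrib, Finset.sum_div, mulVec, dotProduct,
    faceAngleMatrix, of_apply]
  exact Finset.sum_congr rfl fun m _ => by ring

lemma faceAngleMatrix_mulVec_self (k : Fin 4 → ℝ) : faceAngleMatrix k *ᵥ k = 0 := by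
  ext j
  rw [faceAngleMatrix_mulVec_apply, sum_faceSum_mul_self, mul_comm, sub_self, zero_div,
    Pi.zero_apply]

lemma angleMatrix_mulVec_apply (k z : Fin 4 → ℝ) (i : Fin 4) :
    (angleMatrix k *ᵥ z) i =
      ∑ j, (faceAngleMatrix k *ᵥ (k ^ 2 * z)) j - (faceAngleMatrix k *ᵥ (k ^ 2 * z)) i := by
  simp only [mulVec, dotProduct, angleMatrix, of_apply, Pi.mul_apply, Pi.pow_apply, mul_assoc,
    sub_mul, Finset.sum_mul, Finset.sum_sub_distrib]
  rw [Finset.sum_comm]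

lemma angleMatrix_mulVec_inv (hk : ∀ i, 0 < k i) : angleMatrix k *ᵥ k⁻¹ = 0 := by
  have hinv : k ^ 2 * k⁻¹ = k := funext fun i => by
    simp only [Pi.mul_apply, Pi.inv_apply, sq, mul_inv_cancel_right₀ (hk i).ne']
  ext i
  simp [angleMatrix_mulVec_apply, hinv, faceAngleMatrix_mulVec_self]

lemma eq_zero_of_faceSum_eq_zero {z : Fin 4 → ℝ} (hz : ∀ j, faceSum z j = 0) : z = 0 := by
  have hsum : ∑ i, z i = 0 := by
    have := Finset.sum_eq_zero fun j (_ : j ∈ Finset.univ) => hz j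
    simp only [faceSum, Finset.sum_sub_distrib, Finset.sum_const, ← Finset.mul_sum,
      Finset.card_univ, Fintype.card_fin, nsmul_eq_mul] at this
    push_cast at this
    linarith
  ext j
  have := hz j
  rw [faceSum, hsum] at this
  rw [Pi.zero_apply]
  linarith

lemma eq_smul_of_faceAngleMatrix_mulVec_eq_zero (hk : ∀ i, 0 < k i) (hQ : 0 < descartes k)
    {z : Fin 4 → ℝ} (hz : faceAngleMatrix k *ᵥ z = 0) : ∃ c : ℝ, z = c • k := by
  set s := ∑ m, faceSum k m * z m
  have hprop : ∀ j, descartes k * faceSum z j - faceSum k j * s = 0 := fun j => by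
    have := congrFun hz j
    rw [faceAngleMatrix_mulVec_apply, Pi.zero_apply, div_eq_zero_iff] at this
    exact this.resolve_right (descartes_add_faceSum_sq_pos hk j).ne'
  have hdiff : z - (s / descartes k) • k = 0 := eq_zero_of_faceSum_eq_zero fun j => by
    have hlin : faceSum (z - (s / descartes k) • k) j =
        faceSum z j - s / descartes k * faceSum k j := by
      simp only [faceSum, Fin.sum_univ_four, Pi.sub_apply, Pi.smul_apply, smul_eq_mul]
      ring
    rw [hlin, div_mul_eq_mul_div, sub_eq_zero, eq_div_iff hQ.ne']
    linarith [hprop j]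
  exact ⟨_, sub_eq_zero.mp hdiff⟩

lemma eq_smul_inv_of_angleMatrix_mulVec_eq_zero (hk : ∀ i, 0 < k i) (hQ : 0 < descartes k)
    {z : Fin 4 → ℝ} (hz : angleMatrix k *ᵥ z = 0) : ∃ c : ℝ, z = c • k⁻¹ := by
  set y := faceAngleMatrix k *ᵥ (k ^ 2 * z)
  have hsub : ∀ i, ∑ j, y j - y i = 0 := fun i => by
    rw [← angleMatrix_mulVec_apply, hz, Pi.zero_apply]
  have hsum : ∑ j, y j = 0 := by
    have := Finset.sum_eq_zero fun i (_ : i ∈ Finset.univ) => hsub i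
    simp only [Fin.sum_univ_four] at this ⊢
    linarith
  have hy0 : y = 0 := funext fun i => by simpa [hsum] using hsub i
  obtain ⟨c, hc⟩ := eq_smul_of_faceAngleMatrix_mulVec_eq_zero hk hQ hy0
  refine ⟨c, funext fun i => ?_⟩
  have hci := congrFun hc i
  simp only [Pi.mul_apply, Pi.pow_apply, Pi.smul_apply, Pi.inv_apply, smul_eq_mul] at hci ⊢
  have := (hk i).ne'
  field_simp at hci ⊢
  exact hci

/-- The inverse radii of the quadruples of mutually tangent balls whose centers span a nondegenerate
tetrahedron. -/
def descartesCone : Set (Fin 4 → ℝ) := {k | (∀ i, 0 < k i) ∧ 0 < descartes k}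

lemma starConvex_descartesCone : StarConvex ℝ 1 descartesCone := by
  rintro k ⟨hk, hQ⟩ a b ha hb hab
  have hdescartes : descartes (a • 1 + b • k) =
      8 * a ^ 2 + 4 * (a * b) * ∑ i, k i + b ^ 2 * descartes k := by
    simp only [descartes, Fin.sum_univ_four, Pi.add_apply, Pi.smul_apply, Pi.one_apply, smul_eq_mul]
    ring
  have hsum : 0 ≤ ∑ i, k i := Finset.sum_nonneg fun i _ => (hk i).le
  rcases eq_or_lt_of_le ha with rfl | ha
  · rw [zero_add] at hab
    rw [hab, zero_smul, zero_add, one_smul]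
    exact ⟨hk, hQ⟩
  · refine ⟨fun i => ?_, hdescartes ▸ by positivity⟩
    exact add_pos_of_pos_of_nonneg (by simpa using ha) (mul_nonneg hb (hk i).le)

lemma angleMatrix_one : angleMatrix 1 = (1 / 3 : ℝ) • (⊤ : SimpleGraph (Fin 4)).lapMatrix ℝ := by
  have hface : ∀ j m, faceAngleMatrix 1 j m = 1 / 3 - if j = m then 4 / 3 else 0 := fun j m => by
    split_ifs with h <;>
      norm_num [faceAngleMatrix, descartes, faceSum, h]
  ext i m
  rcases eq_or_ne i m with rfl | him
  · norm_num [angleMatrix, hface, SimpleGraph.lapMatrix, SimpleGraph.degMatrix]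
  · norm_num [angleMatrix, hface, SimpleGraph.lapMatrix, SimpleGraph.degMatrix, him]

lemma continuousOn_angleMatrix : ContinuousOn angleMatrix {k | ∀ i, 0 < k i} := by
  have hface : ContinuousOn faceAngleMatrix {k | ∀ i, 0 < k i} := by
    refine continuousOn_pi.mpr fun j => continuousOn_pi.mpr fun m => ?_
    refine ContinuousOn.div ?_ ?_ fun k hk => (descartes_add_faceSum_sq_pos hk j).ne' <;>
    · unfold descartes faceSum
      fun_prop
  unfold angleMatrix
  refine continuousOn_pi.mpr fun j => continuousOn_pi.mpr fun m => ?_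
  have hentry : ∀ j, ContinuousOn (fun k => faceAngleMatrix k j m) {k | ∀ i, 0 < k i} := fun j =>
    continuousOn_pi.mp (continuousOn_pi.mp hface j) m
  simp only [of_apply]
  fun_prop

theorem posSemidef_angleMatrix (hk : ∀ i, 0 < k i) (hQ : 0 < descartes k) :
    (angleMatrix k).PosSemidef := by
  have hone : (1 : Fin 4 → ℝ) ∈ descartesCone := by
    constructor <;> norm_num [descartes]
  have : PreconnectedSpace descartesCone := isPreconnected_iff_preconnectedSpace.mp
    (starConvex_descartesCone.isPathConnected hone).isConnected.isPreconnected
  refine posSemidef_of_preconnectedSpace (X := descartesCone) (A := fun x => angleMatrix x)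
    (k := fun x => (x : Fin 4 → ℝ)⁻¹) (x₀ := ⟨1, hone⟩) ?_ ?_ (fun x => isSymm_angleMatrix x.2.1)
    (fun x => angleMatrix_mulVec_inv x.2.1) ?_
    (fun x _ => eq_smul_inv_of_angleMatrix_mulVec_eq_zero x.2.1 x.2.2) ?_ ⟨k, hk, hQ⟩
  · exact (continuousOn_angleMatrix.mono fun x hx => hx.1).domRestrict
  · exact continuous_pi fun i =>
      ((continuous_apply i).comp continuous_subtype_val).inv₀ fun x => (x.2.1 i).ne'
  · exact fun x hx => (inv_pos.mpr (x.2.1 0)).ne' (congrFun hx 0)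
  · simp only [angleMatrix_one]
    exact ((⊤ : SimpleGraph (Fin 4)).posSemidef_lapMatrix ℝ).smul (by norm_num)

lemma eq_smul_inv_of_dotProduct_angleMatrix_eq_zero (hk : ∀ i, 0 < k i) (hQ : 0 < descartes k)
    {z : Fin 4 → ℝ} (hz : z ⬝ᵥ angleMatrix k *ᵥ z = 0) : ∃ c : ℝ, z = c • k⁻¹ :=
  eq_smul_inv_of_angleMatrix_mulVec_eq_zero hk hQ
    (((posSemidef_angleMatrix hk hQ).dotProduct_mulVec_zero_iff z).mp hz)

end Descartes

section AntitoneOn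

variable {h : ℝ → ℝ} {a b : ℝ}

lemma exists_last_eq {x y c : ℝ} (hxy : x ≤ y) (hcont : ContinuousOn h (Icc x y)) (hx : h x ≤ c)
    (hy : c < h y) : ∃ t ∈ Ico x y, h t = c ∧ ∀ s ∈ Ioc t y, c < h s := by
  have hcompact : IsCompact (Icc x y ∩ h ⁻¹' Iic c) :=
    isCompact_Icc.of_isClosed_subset
      (hcont.preimage_isClosed_of_isClosed isClosed_Icc isClosed_Iic) inter_subset_left
  obtain ⟨t, ⟨ht, htc⟩, hlast⟩ := hcompact.exists_isGreatest ⟨x, left_mem_Icc.mpr hxy, hx⟩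
  have hty : t < y := ht.2.lt_of_ne fun heq => (heq ▸ htc).not_gt hy
  have habove : ∀ s ∈ Ioc t y, c < h s := fun s hs => by
    by_contra! hle
    exact (hlast ⟨⟨ht.1.trans hs.1.le, hs.2⟩, hle⟩).not_gt hs.1
  have hright : Tendsto h (𝓝[Ioc t y] t) (𝓝 (h t)) :=
    (hcont t ht).mono (Ioc_subset_Icc_self.trans (Icc_subset_Icc_left ht.1))
  rw [nhdsWithin_Ioc_eq_nhdsGT hty] at hright
  have hev : ∀ᶠ s in 𝓝[>] t, c ≤ h s := by
    filter_upwards [Ioc_mem_nhdsGT hty] with s hs using (habove s hs).le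
  exact ⟨t, ⟨ht.1, hty⟩, htc.antisymm (ge_of_tendsto hright hev), habove⟩

theorem antitoneOn_of_countable_image (hcont : ContinuousOn h (Icc a b)) {N : Set ℝ}
    (hN : (h '' N).Countable) (hle : ∀ t ∈ Ico a b \ N, ∀ᶠ s in 𝓝[>] t, h s ≤ h t) :
    AntitoneOn h (Icc a b) := by
  intro x hx y hy hxy
  by_contra! hlt
  obtain ⟨c, ⟨hxc, hcy⟩, hcN⟩ : ∃ c ∈ Ioo (h x) (h y), c ∉ h '' N := by
    by_contra! hsub
    exact (Cardinal.Real.Ioo_countable_iff.not.mpr hlt.not_ge) (hN.mono hsub)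
  obtain ⟨t, ht, rfl, habove⟩ :=
    exists_last_eq hxy (hcont.mono (Icc_subset_Icc hx.1 hy.2)) hxc.le hcy
  have hev := hle t ⟨⟨hx.1.trans ht.1, ht.2.trans_le hy.2⟩, fun htN => hcN ⟨t, htN, rfl⟩⟩
  obtain ⟨s, hst, hs⟩ := (hev.and (Ioc_mem_nhdsGT ht.2)).exists
  exact hst.not_gt (habove s hs)

lemma eventually_le_of_eventually_hasDerivAt_nonpos {t : ℝ}
    (hh : ∀ᶠ s in 𝓝 t, ∃ h' ≤ 0, HasDerivAt h h' s) : ∀ᶠ s in 𝓝[>] t, h s ≤ h t := by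
  obtain ⟨ε, hε, hball⟩ := Metric.eventually_nhds_iff_ball.mp hh
  choose! h' hneg hder using hball
  have hanti : AntitoneOn h (Metric.ball t ε) :=
    antitoneOn_of_hasDerivWithinAt_nonpos (convex_ball t ε)
      (fun s hs => (hder s hs).continuousAt.continuousWithinAt)
      (fun s hs => (hder s (interior_subset hs)).hasDerivWithinAt)
      fun s hs => hneg s (interior_subset hs)
  filter_upwards [self_mem_nhdsWithin, nhdsWithin_le_nhds (Metric.ball_mem_nhds t hε)] with s hts hs
  exact hanti (Metric.mem_ball_self hε) hs (le_of_lt hts)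

end AntitoneOn

section VertexAngle

variable {k r : Fin 4 → ℝ}

/-- The signed angle along the edges of the face opposite to the vertex `j` between that face and
the center of the sphere tangent to all six edges, for inverse radii `k`. The dihedral angle at an
edge is the sum of the angles of the two faces containing it. With `arcsin` instead of the usual
`arctan (faceSum k j / √(descartes k))` the definition extends continuously to degenerate
configurations, where it takes the values `± π / 2`. -/
def faceAngle (k : Fin 4 → ℝ) (j : Fin 4) : ℝ :=
  Real.arcsin (faceSum k j / √(descartes k + faceSum k j ^ 2))

lemma faceAngle_eq_arctan (hQ : 0 < descartes k) (j : Fin 4) :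
    faceAngle k j = Real.arctan (faceSum k j / √(descartes k)) := by
  rw [Real.arctan_eq_arcsin, faceAngle, div_div, ← Real.sqrt_mul hQ.le, div_pow,
    Real.sq_sqrt hQ.le, mul_add, mul_one, mul_div_cancel₀ _ hQ.ne']

lemma faceAngle_eq_or (hk : ∀ i, 0 < k i) (hQ : descartes k ≤ 0) (j : Fin 4) :
    faceAngle k j = Real.pi / 2 ∨ faceAngle k j = -(Real.pi / 2) := by
  have hs := Real.sqrt_pos.mpr (descartes_add_faceSum_sq_pos hk j)
  have hle : √(descartes k + faceSum k j ^ 2) ≤ |faceSum k j| := by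
    rw [← Real.sqrt_sq_eq_abs]
    exact Real.sqrt_le_sqrt (by linarith)
  rcases le_abs'.mp hle with h | h
  · exact .inr (Real.arcsin_of_le_neg_one ((div_le_iff₀ hs).mpr (by linarith)))
  · exact .inl (Real.arcsin_of_one_le ((one_le_div hs).mpr h))

lemma faceAngle_smul {c : ℝ} (hc : 0 < c) (k : Fin 4 → ℝ) : faceAngle (c • k) = faceAngle k := by
  ext j
  rw [faceAngle, descartes_smul, faceSum_smul, mul_pow, ← mul_add, Real.sqrt_mul (sq_nonneg c),
    Real.sqrt_sq hc.le, mul_div_mul_left _ _ hc.ne', faceAngle]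

lemma continuous_descartes : Continuous descartes := by unfold descartes; fun_prop

lemma continuousAt_faceAngle (hk : ∀ i, 0 < k i) : ContinuousAt faceAngle k := by
  refine continuousAt_pi.mpr fun j => Real.continuous_arcsin.continuousAt.comp (.div ?_ ?_ ?_)
  · unfold faceSum
    fun_prop
  · unfold descartes faceSum
    fun_prop
  · exact (Real.sqrt_pos.mpr (descartes_add_faceSum_sq_pos hk j)).ne'

lemma hasFDerivAt_faceSum (k : Fin 4 → ℝ) (j : Fin 4) :
    HasFDerivAt (fun k => faceSum k j)
      (∑ i, .proj i - (2 : ℝ) • .proj j : (Fin 4 → ℝ) →L[ℝ] ℝ) k := by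
  have happly : ∀ i, HasFDerivAt (fun k : Fin 4 → ℝ => k i) (ContinuousLinearMap.proj i) k :=
    fun i => hasFDerivAt_apply (𝕜 := ℝ) (F' := fun _ => ℝ) i k
  exact (HasFDerivAt.fun_sum fun i _ => happly i).sub ((happly j).const_mul 2)

lemma hasFDerivAt_descartes (k : Fin 4 → ℝ) :
    HasFDerivAt descartes (∑ j, (2 * faceSum k j) • .proj j : (Fin 4 → ℝ) →L[ℝ] ℝ) k := by
  have happly : ∀ i, HasFDerivAt (fun k : Fin 4 → ℝ => k i) (ContinuousLinearMap.proj i) k :=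
    fun i => hasFDerivAt_apply (𝕜 := ℝ) (F' := fun _ => ℝ) i k
  refine (((HasFDerivAt.fun_sum fun i (_ : i ∈ Finset.univ) => happly i).pow 2).sub
    ((HasFDerivAt.fun_sum fun i (_ : i ∈ Finset.univ) => (happly i).pow 2).const_mul
      2)).congr_fderiv ?_
  ext1 z
  simp only [faceSum, Fin.sum_univ_four, Nat.add_one_sub_one, pow_one, smul_add, nsmul_eq_mul,
    Nat.cast_ofNat, _root_.sub_apply, _root_.add_apply, _root_.smul_apply,
    ContinuousLinearMap.proj_apply, smul_eq_mul]
  ring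

lemma hasFDerivAt_faceAngle (hQ : 0 < descartes k) :
    HasFDerivAt faceAngle
      ((√(descartes k))⁻¹ • (faceAngleMatrix k).mulVecLin.toContinuousLinearMap) k := by
  have heq : faceAngle =ᶠ[𝓝 k] fun k j => Real.arctan (faceSum k j / √(descartes k)) := by
    filter_upwards [continuous_descartes.continuousAt.eventually (lt_mem_nhds hQ)] with k' hk'
      using funext (faceAngle_eq_arctan hk')
  refine HasFDerivAt.congr_of_eventuallyEq ?_ heq
  rw [hasFDerivAt_pi']
  intro j
  have hsqrt : 0 < √(descartes k) := Real.sqrt_pos.mpr hQ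
  have hinv := (hasDerivAt_inv hsqrt.ne').comp_hasFDerivAt k
    ((hasFDerivAt_descartes k).sqrt hQ.ne')
  simp only [div_eq_mul_inv]
  refine ((hasFDerivAt_faceSum k j).mul hinv).arctan.congr_fderiv ?_
  ext1 z
  have hpolar : (∑ m, (2 * faceSum k m) • .proj m : (Fin 4 → ℝ) →L[ℝ] ℝ) z =
      2 * ∑ m, faceSum k m * z m := by
    simp [Finset.mul_sum, mul_assoc]
  have hface : (∑ i, .proj i - (2 : ℝ) • .proj j : (Fin 4 → ℝ) →L[ℝ] ℝ) z = faceSum z j := by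
    simp [faceSum]
  simp only [_root_.smul_apply, _root_.add_apply, ContinuousLinearMap.comp_apply, Pi.mul_apply,
    ContinuousLinearMap.proj_apply, LinearMap.coe_toContinuousLinearMap', mulVecLin_apply,
    Function.comp_apply, Pi.smul_apply, smul_eq_mul, faceAngleMatrix_mulVec_apply, hpolar, hface]
  have hE : √(descartes k) ^ 2 + faceSum k j ^ 2 ≠ 0 := by positivity
  have hsq := (Real.sq_sqrt hQ.le).symm
  generalize √(descartes k) = s at *
  rw [hsq]
  field_simp
  ring

/-- The solid angle at the vertex `i` of the tetrahedron with the edge lengths `r a + r b`, for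
radii `r` such that this tetrahedron exists. The formula extends it continuously to all positive
radii. -/
def vertexAngle (r : Fin 4 → ℝ) (i : Fin 4) : ℝ :=
  2 * (∑ j, faceAngle r⁻¹ j - faceAngle r⁻¹ i) - Real.pi

lemma continuousAt_inv_of_pos (hr : ∀ i, 0 < r i) : ContinuousAt (fun r : Fin 4 → ℝ => r⁻¹) r :=
  continuousAt_pi.mpr fun i => (continuous_apply i).continuousAt.inv₀ (hr i).ne'

lemma continuousAt_vertexAngle (hr : ∀ i, 0 < r i) : ContinuousAt vertexAngle r := by
  have hface : ContinuousAt (fun r : Fin 4 → ℝ => faceAngle r⁻¹) r :=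
    ContinuousAt.comp (g := faceAngle) (continuousAt_faceAngle fun i => inv_pos.mpr (hr i))
      (continuousAt_inv_of_pos hr)
  have happly : ∀ j, ContinuousAt (fun r : Fin 4 → ℝ => faceAngle r⁻¹ j) r :=
    continuousAt_pi.mp hface
  unfold vertexAngle
  fun_prop

lemma hasFDerivAt_vertexAngle (hr : ∀ i, 0 < r i) (hQ : 0 < descartes r⁻¹) :
    HasFDerivAt vertexAngle (-(2 / √(descartes r⁻¹)) •
      (angleMatrix r⁻¹).mulVecLin.toContinuousLinearMap) r := by
  have hinv : HasFDerivAt (fun r : Fin 4 → ℝ => r⁻¹)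
      (ContinuousLinearMap.pi fun i => -(r i ^ 2)⁻¹ • ContinuousLinearMap.proj i) r :=
    hasFDerivAt_pi.mpr fun i => (hasDerivAt_inv (hr i).ne').comp_hasFDerivAt r
      (hasFDerivAt_apply (𝕜 := ℝ) (F' := fun _ => ℝ) i r)
  have hface := hasFDerivAt_pi'.mp ((hasFDerivAt_faceAngle hQ).comp r hinv)
  refine hasFDerivAt_pi'.mpr fun i => ((((HasFDerivAt.fun_sum fun j (_ : j ∈ Finset.univ) =>
    hface j).sub (hface i)).const_mul 2).sub_const Real.pi).congr_fderiv ?_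
  ext1 v
  have hw : (ContinuousLinearMap.pi fun i => -(r i ^ 2)⁻¹ • ContinuousLinearMap.proj (R := ℝ)
      (φ := fun _ => ℝ) i) v = -(r⁻¹ ^ 2 * v) := by
    ext m; simp
  simp only [ContinuousLinearMap.comp_apply, _root_.smul_apply, hw,
    _root_.sub_apply,
    _root_.sum_apply, LinearMap.coe_toContinuousLinearMap', mulVecLin_apply, mulVec_neg,
    ContinuousLinearMap.proj_apply, Pi.smul_apply, Pi.neg_apply, smul_eq_mul,
    angleMatrix_mulVec_apply, ← Finset.mul_sum, Finset.sum_neg_distrib]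
  ring

lemma vertexAngle_smul {c : ℝ} (hc : 0 < c) (r : Fin 4 → ℝ) :
    vertexAngle (c • r) = vertexAngle r := by
  have hinv : (c • r)⁻¹ = c⁻¹ • r⁻¹ := funext fun i => by simp [mul_comm]
  ext i
  simp only [vertexAngle, hinv, faceAngle_smul (inv_pos.mpr hc)]

lemma vertexAngle_comp_perm (r : Fin 4 → ℝ) (σ : Equiv.Perm (Fin 4)) (i : Fin 4) :
    vertexAngle (r ∘ σ) i = vertexAngle r (σ i) := by
  have hsum : ∀ f : Fin 4 → ℝ, ∑ i, f (σ i) = ∑ i, f i := fun f => Equiv.sum_comp σ f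
  have hface : ∀ j, faceAngle (r ∘ σ)⁻¹ j = faceAngle r⁻¹ (σ j) := fun j => by
    simp only [faceAngle, faceSum, descartes, Pi.inv_apply, Function.comp_apply,
      hsum fun i => (r i)⁻¹, hsum fun i => (r i)⁻¹ ^ 2]
  simp only [vertexAngle, hface, hsum (faceAngle r⁻¹)]

/-- The Schläfli formula `∑ i, r i * dα i = 0`, where `α = vertexAngle`. -/
theorem hasFDerivAt_vertexAngle_dotProduct_self (hr : ∀ i, 0 < r i) (hQ : 0 < descartes r⁻¹) :
    HasFDerivAt (fun x => vertexAngle x ⬝ᵥ r) (0 : (Fin 4 → ℝ) →L[ℝ] ℝ) r := by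
  have hk : ∀ i, 0 < r⁻¹ i := fun i => inv_pos.mpr (hr i)
  have hker (v : Fin 4 → ℝ) : r ⬝ᵥ angleMatrix r⁻¹ *ᵥ v = 0 :=
    dotProduct_mulVec_eq_zero_of_isSymm (isSymm_angleMatrix hk)
      (by simpa only [inv_inv] using angleMatrix_mulVec_inv hk) v
  have hangle := hasFDerivAt_pi'.mp (hasFDerivAt_vertexAngle hr hQ)
  refine (HasFDerivAt.fun_sum fun i (_ : i ∈ Finset.univ) =>
    (hangle i).mul_const (r i)).congr_fderiv ?_
  ext1 v
  simp only [_root_.sum_apply, _root_.smul_apply, ContinuousLinearMap.comp_apply,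
    ContinuousLinearMap.proj_apply, LinearMap.coe_toContinuousLinearMap', mulVecLin_apply,
    Pi.smul_apply, smul_eq_mul, mul_left_comm (r _), ← Finset.mul_sum]
  exact mul_eq_zero_of_right _ (hker v)

lemma hasDerivAt_vertexAngle_dotProduct {v : Fin 4 → ℝ} {t : ℝ} (w : Fin 4 → ℝ)
    (hr : ∀ i, 0 < (r + t • v) i) (hQ : 0 < descartes (r + t • v)⁻¹) :
    HasDerivAt (fun s : ℝ => vertexAngle (r + s • v) ⬝ᵥ w)
      (-(2 / √(descartes (r + t • v)⁻¹)) * (w ⬝ᵥ angleMatrix (r + t • v)⁻¹ *ᵥ v)) t := by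
  have hline : HasDerivAt (fun s : ℝ => r + s • v) v t := by
    simpa using ((hasDerivAt_id t).smul_const v).const_add r
  have hangle := hasDerivAt_pi.mp ((hasFDerivAt_vertexAngle hr hQ).comp_hasDerivAt t hline)
  refine (HasDerivAt.fun_sum fun i (_ : i ∈ Finset.univ) =>
    (hangle i).mul_const (w i)).congr_deriv ?_
  simp only [_root_.smul_apply, LinearMap.coe_toContinuousLinearMap', mulVecLin_apply,
    Pi.smul_apply, smul_eq_mul, mul_assoc, ← Finset.mul_sum]
  rw [dotProduct_comm]
  rfl

end VertexAngle

section Segment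

variable {a b : Fin 4 → ℝ}

lemma add_smul_sub_pos (ha : ∀ i, 0 < a i) (hb : ∀ i, 0 < b i) {t : ℝ} (ht : t ∈ Icc (0 : ℝ) 1)
    (i : Fin 4) : 0 < (a + t • (b - a)) i :=
  (convex_Ioi (0 : ℝ)).add_smul_sub_mem (ha i) (hb i) ht

lemma antitoneOn_vertexAngle_dotProduct (ha : ∀ i, 0 < a i) (hb : ∀ i, 0 < b i) :
    AntitoneOn (fun t : ℝ => vertexAngle (a + t • (b - a)) ⬝ᵥ (b - a)) (Icc 0 1) := by
  have hpos {t : ℝ} (ht : t ∈ Icc (0 : ℝ) 1) := add_smul_sub_pos ha hb ht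
  have hline : Continuous fun t : ℝ => a + t • (b - a) := by fun_prop
  refine antitoneOn_of_countable_image
    (N := {t | (∀ i, 0 < (a + t • (b - a)) i) ∧ descartes (a + t • (b - a))⁻¹ ≤ 0}) ?_ ?_ ?_
  · have hangle : ContinuousOn (fun t : ℝ => vertexAngle (a + t • (b - a))) (Icc 0 1) := fun t ht =>
      ((continuousAt_vertexAngle (hpos ht)).comp
        (f := fun t : ℝ => a + t • (b - a)) hline.continuousAt).continuousWithinAt
    unfold dotProduct
    fun_prop
  · have hfinite : (univ.pi fun _ : Fin 4 => ({Real.pi / 2, -(Real.pi / 2)} : Set ℝ)).Finite :=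
      Finite.pi fun _ => toFinite _
    refine ((hfinite.image fun θ : Fin 4 → ℝ =>
      (fun i => 2 * (∑ j, θ j - θ i) - Real.pi) ⬝ᵥ (b - a)).subset ?_).countable
    rintro _ ⟨t, ⟨ht, hQ⟩, rfl⟩
    exact ⟨faceAngle (a + t • (b - a))⁻¹,
      fun j _ => faceAngle_eq_or (fun i => inv_pos.mpr (ht i)) hQ j, rfl⟩
  · rintro t ⟨ht, hQ⟩
    have ht' := hpos (Ico_subset_Icc_self ht)
    have hdescartes : ContinuousAt (fun s : ℝ => descartes (a + s • (b - a))⁻¹) t :=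
      continuous_descartes.continuousAt.comp
        ((continuousAt_inv_of_pos ht').comp (f := fun t : ℝ => a + t • (b - a)) hline.continuousAt)
    refine eventually_le_of_eventually_hasDerivAt_nonpos ?_
    have hQt : 0 < descartes (a + t • (b - a))⁻¹ := not_le.mp fun h => hQ ⟨ht', h⟩
    filter_upwards [eventually_all.mpr fun i =>
      ((continuous_apply i).comp hline).continuousAt.eventually (lt_mem_nhds (ht' i)),
      hdescartes.eventually (lt_mem_nhds hQt)] with s hs hQs
    refine ⟨_, ?_, hasDerivAt_vertexAngle_dotProduct (b - a) hs hQs⟩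
    have hsemidef := posSemidef_angleMatrix (fun i => inv_pos.mpr (hs i)) hQs
    exact mul_nonpos_of_nonpos_of_nonneg (neg_nonpos.mpr (by positivity))
      (hsemidef.dotProduct_mulVec_nonneg (b - a))

theorem vertexAngle_sub_dotProduct_sub_nonpos (ha : ∀ i, 0 < a i) (hb : ∀ i, 0 < b i) :
    (vertexAngle b - vertexAngle a) ⬝ᵥ (b - a) ≤ 0 := by
  have hanti := antitoneOn_vertexAngle_dotProduct ha hb (left_mem_Icc.mpr zero_le_one)
    (right_mem_Icc.mpr zero_le_one) zero_le_one
  simpa only [zero_smul, add_zero, one_smul, add_sub_cancel, sub_dotProduct, sub_nonpos] using hanti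

theorem eq_smul_of_vertexAngle_sub_dotProduct_sub_eq_zero (ha : ∀ i, 0 < a i) (hb : ∀ i, 0 < b i)
    (hQ : 0 < descartes a⁻¹) (h : (vertexAngle b - vertexAngle a) ⬝ᵥ (b - a) = 0) :
    ∃ c : ℝ, b = c • a := by
  have hanti := antitoneOn_vertexAngle_dotProduct ha hb
  have hends : vertexAngle (a + (1 : ℝ) • (b - a)) ⬝ᵥ (b - a) =
      vertexAngle (a + (0 : ℝ) • (b - a)) ⬝ᵥ (b - a) := by
    rw [zero_smul, add_zero, one_smul, add_sub_cancel, ← sub_eq_zero, ← sub_dotProduct, h]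
  have hconst : ∀ t ∈ Icc (0 : ℝ) 1, vertexAngle (a + t • (b - a)) ⬝ᵥ (b - a) =
      vertexAngle (a + (0 : ℝ) • (b - a)) ⬝ᵥ (b - a) := fun t ht =>
    (hanti (left_mem_Icc.mpr zero_le_one) ht ht.1).antisymm
      (hends.symm.trans_le (hanti ht (right_mem_Icc.mpr zero_le_one) ht.2))
  have hzero := (hasDerivWithinAt_const (0 : ℝ) (Icc 0 1) _).congr hconst rfl
  have ha0 : a + (0 : ℝ) • (b - a) = a := by rw [zero_smul, add_zero]
  have hder := hasDerivAt_vertexAngle_dotProduct (t := 0) (v := b - a) (b - a) (ha0.symm ▸ ha)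
    (ha0.symm ▸ hQ)
  rw [ha0] at hder
  have hform := (uniqueDiffOn_Icc zero_lt_one 0 (left_mem_Icc.mpr zero_le_one)).eq_deriv _
    hder.hasDerivWithinAt hzero
  have hcoeff : -(2 / √(descartes a⁻¹)) ≠ 0 :=
    neg_ne_zero.mpr (div_pos two_pos (Real.sqrt_pos.mpr hQ)).ne'
  have hk : ∀ i, 0 < a⁻¹ i := fun i => inv_pos.mpr (ha i)
  obtain ⟨c, hc⟩ := eq_smul_inv_of_dotProduct_angleMatrix_eq_zero hk hQ
    ((mul_eq_zero.mp hform).resolve_left hcoeff)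
  refine ⟨c + 1, ?_⟩
  rw [add_smul, one_smul, ← sub_eq_iff_eq_add, hc, inv_inv]

end Segment

section HalfSpace

open Metric
open scoped InnerProductSpace Pointwise

variable {E : Type*} [NormedAddCommGroup E] [InnerProductSpace ℝ E]

/-- The open half space with inner normal `n`. -/
def openHalfSpace (n : E) : Set E := {x | 0 < ⟪n, x⟫_ℝ}

lemma Ioo_smul_image_sphere {K : Set E}
    (hK : ∀ c : ℝ, 0 < c → ∀ x ∈ K, c • x ∈ K) :
    Ioo (0 : ℝ) 1 • ((↑) '' {u : sphere (0 : E) 1 | (u : E) ∈ K} : Set E) =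
      (K ∩ ball 0 1) \ {0} := by
  ext x
  simp only [Set.mem_smul, mem_image, Set.mem_sdiff, mem_inter_iff, mem_ball_zero_iff,
    mem_singleton_iff]
  constructor
  · rintro ⟨t, ht, _, ⟨u, hu, rfl⟩, rfl⟩
    have hnorm : ‖t • (u : E)‖ = t := by
      rw [norm_smul, norm_eq_of_mem_sphere, mul_one, Real.norm_of_nonneg ht.1.le]
    exact ⟨⟨hK t ht.1 u hu, hnorm.trans_lt ht.2⟩, norm_pos_iff.mp (ht.1.trans_eq hnorm.symm)⟩
  · rintro ⟨⟨hxK, hx1⟩, hx0⟩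
    have hx : 0 < ‖x‖ := norm_pos_iff.mpr hx0
    exact ⟨‖x‖, ⟨hx, hx1⟩, ‖x‖⁻¹ • x, ⟨⟨‖x‖⁻¹ • x, by simp [norm_smul, hx.ne']⟩,
      hK _ (inv_pos.mpr hx) x hxK, rfl⟩, smul_inv_smul₀ hx.ne' x⟩

variable [MeasurableSpace E]

section BorelSpace

variable [BorelSpace E]

lemma measurableSet_openHalfSpace (n : E) : MeasurableSet (openHalfSpace n) :=
  measurableSet_lt measurable_const (by fun_prop)

lemma toSphere_real_setOf_mem [FiniteDimensional ℝ E] [Nontrivial E] (μ : Measure E)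
    [μ.IsAddHaarMeasure] {K : Set E} (hK : MeasurableSet K)
    (hsmul : ∀ c : ℝ, 0 < c → ∀ x ∈ K, c • x ∈ K) :
    μ.toSphere.real {u | (u : E) ∈ K} = finrank ℝ E * (μ.restrict (ball 0 1)).real K := by
  have hK' : MeasurableSet {u : sphere (0 : E) 1 | (u : E) ∈ K} := measurable_subtype_coe hK
  rw [measureReal_def, Measure.toSphere_apply' _ hK',
    Ioo_smul_image_sphere hsmul, measure_sdiff_null (measure_singleton _),
    ENNReal.toReal_mul, ENNReal.toReal_natCast, measureReal_def, Measure.restrict_apply hK]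

lemma measure_setOf_inner_eq_zero [FiniteDimensional ℝ E] (μ : Measure E) [μ.IsAddHaarMeasure]
    {n : E} (hn : n ≠ 0) : μ {x | ⟪n, x⟫_ℝ = 0} = 0 :=
  μ.addHaar_submodule (LinearMap.ker (innerₛₗ ℝ n)) fun htop =>
    hn <| inner_self_eq_zero.mp (LinearMap.mem_ker.mp (htop ▸ Submodule.mem_top (x := n)))

end BorelSpace

variable {μ : Measure E} (hμ : ∀ n : E, n ≠ 0 → ∀ᵐ x ∂μ, ⟪n, x⟫_ℝ ≠ 0) {a b c : E}

include hμ

lemma neg_openHalfSpace_ae_eq (ha : a ≠ 0) :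
    (-openHalfSpace a : Set E) =ᵐ[μ] ((openHalfSpace a)ᶜ : Set E) := by
  refine eventuallyEq_set.mpr ?_
  filter_upwards [hμ a ha] with x hx
  simp only [openHalfSpace, Set.mem_neg, mem_ofPred_eq, inner_neg_right, neg_pos, mem_compl_iff,
    not_lt]
  exact ⟨le_of_lt, fun h => h.lt_of_ne hx⟩

variable [BorelSpace E] [IsFiniteMeasure μ] [μ.IsNegInvariant]

lemma measureReal_openHalfSpace (ha : a ≠ 0) : μ.real (openHalfSpace a) = μ.real univ / 2 := by
  have hcompl := measureReal_add_measureReal_compl (μ := μ) (measurableSet_openHalfSpace a)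
  have hneg : μ.real (openHalfSpace a)ᶜ = μ.real (openHalfSpace a) := by
    rw [← measureReal_congr (neg_openHalfSpace_ae_eq hμ ha), measureReal_def, Measure.measure_neg,
      measureReal_def]
  linarith

/-- The complement of the union of three half spaces is, up to a null set, the antipode of their
intersection. Therefore inclusion–exclusion determines the measure of the intersection. -/
lemma measureReal_inter_openHalfSpace (ha : a ≠ 0) (hb : b ≠ 0) (hc : c ≠ 0) :
    2 * μ.real (openHalfSpace a ∩ openHalfSpace b ∩ openHalfSpace c) =
      μ.real (openHalfSpace a ∩ openHalfSpace b) + μ.real (openHalfSpace a ∩ openHalfSpace c) +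
        μ.real (openHalfSpace b ∩ openHalfSpace c) - μ.real univ / 2 := by
  have hA := measureReal_openHalfSpace hμ ha
  have hB := measureReal_openHalfSpace hμ hb
  have hC := measureReal_openHalfSpace hμ hc
  have hantipode : μ.real (openHalfSpace a ∪ openHalfSpace b ∪ openHalfSpace c)ᶜ =
      μ.real (openHalfSpace a ∩ openHalfSpace b ∩ openHalfSpace c) := by
    rw [compl_union, compl_union, ← measureReal_congr
      (((neg_openHalfSpace_ae_eq hμ ha).inter (neg_openHalfSpace_ae_eq hμ hb)).inter
        (neg_openHalfSpace_ae_eq hμ hc)), ← Set.inter_neg, ← Set.inter_neg, measureReal_def,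
      Measure.measure_neg, measureReal_def]
  have mA := measurableSet_openHalfSpace a
  have mB := measurableSet_openHalfSpace b
  have mC := measurableSet_openHalfSpace c
  have hcompl := measureReal_add_measureReal_compl (μ := μ) ((mA.union mB).union mC)
  have hunion := measureReal_union_add_inter (μ := μ) (s := openHalfSpace a ∪ openHalfSpace b) mC
  have hunion' := measureReal_union_add_inter (μ := μ) (s := openHalfSpace a) mB
  have hunion'' := measureReal_union_add_inter (μ := μ) (s := openHalfSpace a ∩ openHalfSpace c)
    (mB.inter mC)
  rw [union_inter_distrib_right] at hunion
  rw [← inter_inter_distrib_right] at hunion''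
  linarith

end HalfSpace

section Wedge

open Metric InnerProductGeometry
open scoped InnerProductSpace ENNReal

variable {E : Type*} [NormedAddCommGroup E] [InnerProductSpace ℝ E]

lemma angle_mem_Ioo_of_linearIndependent {m n : E} (h : LinearIndependent ℝ ![m, n]) :
    angle m n ∈ Ioo 0 Real.pi := by
  have hpair := (LinearIndependent.pair_iff' (h.ne_zero 0)).mp h
  refine ⟨(angle_nonneg m n).lt_of_ne fun h0 => ?_, (angle_le_pi m n).lt_of_ne fun hπ => ?_⟩
  · obtain ⟨-, r, -, hr⟩ := angle_eq_zero_iff.mp h0.symm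
    exact hpair r hr.symm
  · obtain ⟨-, r, -, hr⟩ := angle_eq_pi_iff.mp hπ
    exact hpair r hr.symm

lemma exists_orthonormal_pair {m n : E} (h : LinearIndependent ℝ ![m, n]) :
    ∃ a b : E, Orthonormal ℝ ![a, b] ∧ m = ‖m‖ • a ∧
      n = ‖n‖ • (Real.cos (angle m n) • a + Real.sin (angle m n) • b) := by
  have hm : ‖m‖ ≠ 0 := norm_ne_zero_iff.mpr (h.ne_zero 0)
  have hn : ‖n‖ ≠ 0 := norm_ne_zero_iff.mpr (h.ne_zero 1)
  obtain ⟨hγ0, hγπ⟩ := angle_mem_Ioo_of_linearIndependent h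
  have hs := (Real.sin_pos_of_pos_of_lt_pi hγ0 hγπ).ne'
  set γ := angle m n
  set a := ‖m‖⁻¹ • m with ha
  set u := ‖n‖⁻¹ • n with hu
  have hma : m = ‖m‖ • a := (smul_inv_smul₀ hm m).symm
  have hnu : n = ‖n‖ • u := (smul_inv_smul₀ hn n).symm
  have haa : ⟪a, a⟫_ℝ = 1 := by
    rw [real_inner_self_eq_norm_sq, ha, norm_smul, norm_inv, norm_norm, inv_mul_cancel₀ hm, one_pow]
  have huu : ⟪u, u⟫_ℝ = 1 := by
    rw [real_inner_self_eq_norm_sq, hu, norm_smul, norm_inv, norm_norm, inv_mul_cancel₀ hn, one_pow]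
  have hau : ⟪a, u⟫_ℝ = Real.cos γ := by
    rw [ha, hu, real_inner_smul_left, real_inner_smul_right, ← cos_angle_mul_norm_mul_norm]
    field_simp
    rfl
  have hua : ⟪u, a⟫_ℝ = Real.cos γ := by rw [real_inner_comm, hau]
  have hab : ⟪a, (Real.sin γ)⁻¹ • (u - Real.cos γ • a)⟫_ℝ = 0 := by
    rw [real_inner_smul_right, inner_sub_right, hau, real_inner_smul_right, haa, mul_one, sub_self,
      mul_zero]
  have hbb : ⟪(Real.sin γ)⁻¹ • (u - Real.cos γ • a),
      (Real.sin γ)⁻¹ • (u - Real.cos γ • a)⟫_ℝ = 1 := by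
    simp only [real_inner_smul_right, real_inner_smul_left, inner_sub_right, inner_sub_left, hau,
      hua, huu, haa]
    field_simp
    linear_combination -Real.sin_sq_add_cos_sq γ
  refine ⟨a, (Real.sin γ)⁻¹ • (u - Real.cos γ • a), ?_, hma, ?_⟩
  · simp only [orthonormal_iff_ite, Fin.forall_fin_two, cons_val_zero, cons_val_one, haa, hab, hbb,
      real_inner_comm a]
    simp
  · rw [smul_inv_smul₀ hs, add_sub_cancel, ← hnu]

lemma cos_pos_and_cos_sub_pos_iff {γ θ : ℝ} (hγ : γ ∈ Ioo 0 Real.pi)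
    (hθ : θ ∈ Ioo (-Real.pi) Real.pi) :
    0 < Real.cos θ ∧ 0 < Real.cos (θ - γ) ↔ θ ∈ Ioo (γ - Real.pi / 2) (Real.pi / 2) := by
  obtain ⟨hγ0, hγπ⟩ := hγ
  obtain ⟨hθ0, hθπ⟩ := hθ
  constructor
  · rintro ⟨hcos, hcos'⟩
    have hθ2 : θ < Real.pi / 2 := by
      by_contra! hle
      exact hcos.not_ge (Real.cos_nonpos_of_pi_div_two_le_of_le hle (by linarith))
    have hθ1 : -(Real.pi / 2) < θ := by
      by_contra! hle
      rw [← Real.cos_neg] at hcos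
      exact hcos.not_ge (Real.cos_nonpos_of_pi_div_two_le_of_le (by linarith) (by linarith))
    refine ⟨?_, hθ2⟩
    by_contra! hle
    rw [← Real.cos_neg] at hcos'
    exact hcos'.not_ge (Real.cos_nonpos_of_pi_div_two_le_of_le (by linarith) (by linarith))
  · rintro ⟨hθ1, hθ2⟩
    exact ⟨Real.cos_pos_of_mem_Ioo ⟨by linarith, hθ2⟩,
      Real.cos_pos_of_mem_Ioo ⟨by linarith, by linarith⟩⟩

/-- The measure on Euclidean three-space whose value on a cone is a third of the area that the cone
cuts out of the unit sphere: the volume, restricted to the unit ball. -/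
def ballMeasure : Measure E3 := volume.restrict (ball 0 1)

instance : IsFiniteMeasure ballMeasure :=
  ⟨by simp [ballMeasure]⟩

lemma measurePreserving_ballMeasure (f : E3 ≃ₗᵢ[ℝ] E3) :
    MeasurePreserving f ballMeasure ballMeasure := by
  have h := f.measurePreserving.restrict_preimage (measurableSet_ball (x := 0) (ε := 1))
  rwa [LinearIsometryEquiv.preimage_ball, map_zero] at h

instance : ballMeasure.IsNegInvariant :=
  ⟨(measurePreserving_ballMeasure (LinearIsometryEquiv.neg ℝ)).map_eq⟩

lemma ae_ballMeasure_inner_ne_zero {n : E3} (hn : n ≠ 0) : ∀ᵐ x ∂ballMeasure, ⟪n, x⟫_ℝ ≠ 0 := by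
  refine ae_restrict_of_ae (ae_iff.mpr ?_)
  simpa only [not_not] using measure_setOf_inner_eq_zero volume hn

lemma ballMeasure_real_univ : ballMeasure.real univ = 4 * Real.pi / 3 := by
  rw [measureReal_def, ballMeasure, Measure.restrict_apply_univ,
    EuclideanSpace.volume_ball_fin_three]
  simp only [ENNReal.ofReal_one, one_pow, one_mul]
  rw [ENNReal.toReal_ofReal (by positivity)]
  ring

/-- The projection of Euclidean space to the plane of the first two coordinates, viewed as the
complex plane so that polar coordinates can be used. -/
def planeProj (x : E3) : ℂ := ⟨x 0, x 1⟩

lemma measurePreserving_prodMk_planeProj : MeasurePreserving fun x : E3 => (x 2, planeProj x) := by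
  have hvec := EuclideanSpace.volume_preserving_symm_measurableEquiv_toLp (Fin 3)
  have hsplit := volume_preserving_piFinSuccAbove (fun _ : Fin 3 => ℝ) 2
  have hplane := (MeasurePreserving.id (volume : Measure ℝ)).prod
    (Complex.volume_preserving_equiv_pi.symm Complex.measurableEquivPi)
  convert hplane.comp (hsplit.comp hvec) using 1
  · exact funext fun x => Prod.ext rfl (Complex.mk_eq_add_mul_I _ _)
  · exact Measure.volume_eq_prod _ _

lemma norm_sq_eq_add_norm_planeProj_sq (x : E3) : ‖x‖ ^ 2 = x 2 ^ 2 + ‖planeProj x‖ ^ 2 := by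
  rw [EuclideanSpace.real_norm_sq_eq, Fin.sum_univ_three, Complex.sq_norm, Complex.normSq_apply,
    planeProj]
  ring

lemma measurable_planeProj : Measurable planeProj :=
  measurePreserving_prodMk_planeProj.measurable.snd

lemma ballMeasure_planeProj_preimage {A : Set ℂ} (hA : MeasurableSet A) :
    ballMeasure (planeProj ⁻¹' A) = ∫⁻ w in A, volume {y : ℝ | y ^ 2 + ‖w‖ ^ 2 < 1} := by
  set S : Set (ℝ × ℂ) := {p | p.1 ^ 2 + ‖p.2‖ ^ 2 < 1} with hS
  have hSm : MeasurableSet S :=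
    measurableSet_lt (f := fun p : ℝ × ℂ => p.1 ^ 2 + ‖p.2‖ ^ 2) (by fun_prop) measurable_const
  have hpre : planeProj ⁻¹' A ∩ ball 0 1 =
      (fun x : E3 => (x 2, planeProj x)) ⁻¹' (S ∩ Prod.snd ⁻¹' A) := by
    ext x
    rw [mem_inter_iff, mem_ball_zero_iff, ← sq_lt_one_iff₀ (norm_nonneg x),
      norm_sq_eq_add_norm_planeProj_sq]
    exact and_comm
  have hSA := hSm.inter (measurable_snd hA)
  rw [ballMeasure, Measure.restrict_apply (measurable_planeProj hA), hpre,
    measurePreserving_prodMk_planeProj.measure_preimage hSA.nullMeasurableSet,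
    Measure.volume_eq_prod, Measure.prod_apply_symm hSA, ← lintegral_indicator hA]
  refine lintegral_congr fun w => ?_
  by_cases hw : w ∈ A <;> simp [hS, hw, preimage]

/-- In polar coordinates the ball measure is a product, so a sector has measure proportional to its
angle. -/
lemma exists_ballMeasure_sector : ∃ C : ℝ≥0∞, ∀ (A : Set ℂ) (s : Set ℝ), MeasurableSet A →
    MeasurableSet s → s ⊆ Ioo (-Real.pi) Real.pi →
    (∀ ρ > 0, ∀ θ ∈ Ioo (-Real.pi) Real.pi, Complex.polarCoord.symm (ρ, θ) ∈ A ↔ θ ∈ s) →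
    ballMeasure (planeProj ⁻¹' A) = C * volume s := by
  set height : ℝ → ℝ≥0∞ := fun ρ => volume {y : ℝ | y ^ 2 + |ρ| ^ 2 < 1} with hheight
  refine ⟨∫⁻ ρ in Ioi (0 : ℝ), ENNReal.ofReal ρ * height ρ, fun A s hA hs hsub h => ?_⟩
  have hmeas : Measurable height := by
    have : MeasurableSet {p : ℝ × ℝ | p.2 ^ 2 + |p.1| ^ 2 < 1} := by
      refine measurableSet_lt (f := fun p : ℝ × ℝ => p.2 ^ 2 + |p.1| ^ 2) ?_ measurable_const
      simp only [sq_abs]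
      fun_prop
    exact measurable_measure_prodMk_left this
  have hpolar : ∀ p ∈ polarCoord.target, ENNReal.ofReal p.1 •
      A.indicator (fun w => volume {y : ℝ | y ^ 2 + ‖w‖ ^ 2 < 1}) (Complex.polarCoord.symm p) =
      (ENNReal.ofReal p.1 * height p.1) * s.indicator 1 p.2 := by
    rintro ⟨ρ, θ⟩ ⟨hρ, hθ⟩
    have hiff := h ρ hρ θ hθ
    by_cases hθs : θ ∈ s
    · simp only [indicator_of_mem (hiff.mpr hθs), indicator_of_mem hθs,
        Complex.norm_polarCoord_symm, smul_eq_mul, Pi.one_apply, mul_one, hheight]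
    · simp only [indicator_of_notMem (hiff.not.mpr hθs), indicator_of_notMem hθs, smul_zero,
        mul_zero]
  rw [ballMeasure_planeProj_preimage hA, ← lintegral_indicator hA,
    ← Complex.lintegral_comp_polarCoord_symm,
    setLIntegral_congr_fun polarCoord.open_target.measurableSet hpolar, polarCoord_target,
    Measure.volume_eq_prod, ← Measure.prod_restrict,
    lintegral_prod_mul (f := fun ρ : ℝ => ENNReal.ofReal ρ * height ρ)
      (g := s.indicator 1) ((by fun_prop : AEMeasurable _ _).mul hmeas.aemeasurable)
      (measurable_one.indicator hs).aemeasurable,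
    lintegral_indicator_one hs, Measure.restrict_apply hs, inter_eq_left.mpr hsub]

lemma ballMeasure_real_sector {A : Set ℂ} {s : Set ℝ} (hA : MeasurableSet A) (hs : MeasurableSet s)
    (hsub : s ⊆ Ioo (-Real.pi) Real.pi)
    (h : ∀ ρ > 0, ∀ θ ∈ Ioo (-Real.pi) Real.pi, Complex.polarCoord.symm (ρ, θ) ∈ A ↔ θ ∈ s) :
    ballMeasure.real (planeProj ⁻¹' A) = 2 / 3 * volume.real s := by
  obtain ⟨C, hC⟩ := exists_ballMeasure_sector
  have hball : 4 * Real.pi / 3 = C.toReal * (2 * Real.pi) := by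
    have huniv := congrArg ENNReal.toReal <| hC univ _ .univ measurableSet_Ioo Subset.rfl
      fun _ _ _ hθ => iff_of_true (mem_univ _) hθ
    rwa [preimage_univ, ← measureReal_def, ballMeasure_real_univ, ENNReal.toReal_mul,
      ← measureReal_def, Real.volume_real_Ioo_of_le (by linarith [Real.pi_pos]), sub_neg_eq_add,
      ← two_mul] at huniv
  have hconst : C.toReal = 2 / 3 := by
    field_simp at hball
    linarith
  rw [measureReal_def, hC A s hA hs hsub h, ENNReal.toReal_mul, hconst, measureReal_def]

lemma ballMeasure_real_coord_wedge {γ : ℝ} (hγ : γ ∈ Ioo 0 Real.pi) :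
    ballMeasure.real {x | 0 < x 0 ∧ 0 < Real.cos γ * x 0 + Real.sin γ * x 1} =
      2 / 3 * (Real.pi - γ) := by
  obtain ⟨hγ0, hγπ⟩ := id hγ
  have hA : MeasurableSet {w : ℂ | 0 < w.re ∧ 0 < Real.cos γ * w.re + Real.sin γ * w.im} :=
    (measurableSet_lt measurable_const Complex.measurable_re).inter
      (measurableSet_lt (g := fun w : ℂ => Real.cos γ * w.re + Real.sin γ * w.im)
        measurable_const (by fun_prop))
  have hsub : Ioo (γ - Real.pi / 2) (Real.pi / 2) ⊆ Ioo (-Real.pi) Real.pi :=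
    Ioo_subset_Ioo (by linarith) (by linarith)
  refine (ballMeasure_real_sector hA measurableSet_Ioo hsub fun ρ hρ θ hθ => ?_).trans ?_
  · have hre : (Complex.polarCoord.symm (ρ, θ)).re = ρ * Real.cos θ := by
      simp [Complex.cos_ofReal_re, Complex.sin_ofReal_im]
    have him : (Complex.polarCoord.symm (ρ, θ)).im = ρ * Real.sin θ := by
      simp [Complex.cos_ofReal_im, Complex.sin_ofReal_re]
    have hcos : Real.cos γ * (ρ * Real.cos θ) + Real.sin γ * (ρ * Real.sin θ) =
        ρ * Real.cos (θ - γ) := by rw [Real.cos_sub]; ring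
    rw [mem_ofPred_eq, hre, him, hcos, mul_pos_iff_of_pos_left hρ, mul_pos_iff_of_pos_left hρ,
      cos_pos_and_cos_sub_pos_iff hγ hθ]
  · rw [Real.volume_real_Ioo_of_le (by linarith)]
    ring

lemma exists_orthonormalBasis_extension_pair {a b : E3} (h : Orthonormal ℝ ![a, b]) :
    ∃ e : OrthonormalBasis (Fin 3) ℝ E3, e 0 = a ∧ e 1 = b := by
  have hrestrict : Orthonormal ℝ (({0, 1} : Set (Fin 3)).domRestrict ![a, b, 0]) := by
    rw [orthonormal_iff_ite] at h ⊢
    rintro ⟨i, rfl | rfl⟩ ⟨j, rfl | rfl⟩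
    exacts [h 0 0, h 0 1, h 1 0, h 1 1]
  obtain ⟨e, he⟩ := hrestrict.exists_orthonormalBasis_extension_of_card_eq (by simp)
  exact ⟨e, he 0 (by simp), he 1 (by simp)⟩

lemma ballMeasure_real_wedge {m n : E3} (h : LinearIndependent ℝ ![m, n]) :
    ballMeasure.real (openHalfSpace m ∩ openHalfSpace n) = 2 / 3 * (Real.pi - angle m n) := by
  obtain ⟨a, b, hab, hm, hn⟩ := exists_orthonormal_pair h
  obtain ⟨e, rfl, rfl⟩ := exists_orthonormalBasis_extension_pair hab
  have hm0 : 0 < ‖m‖ := norm_pos_iff.mpr (h.ne_zero 0)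
  have hn0 : 0 < ‖n‖ := norm_pos_iff.mpr (h.ne_zero 1)
  have hγ := angle_mem_Ioo_of_linearIndependent h
  set γ := angle m n
  have hwedge : openHalfSpace m ∩ openHalfSpace n = e.repr ⁻¹'
      {x | 0 < x 0 ∧ 0 < Real.cos γ * x 0 + Real.sin γ * x 1} := by
    ext x
    rw [openHalfSpace, openHalfSpace, hm, hn]
    simp only [mem_inter_iff, mem_ofPred_eq, mem_preimage, e.repr_apply_apply,
      real_inner_smul_left, inner_add_left, mul_pos_iff_of_pos_left hm0,
      mul_pos_iff_of_pos_left hn0]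
  rw [hwedge, ← ballMeasure_real_coord_wedge hγ, measureReal_def,
    (measurePreserving_ballMeasure e.repr).measure_preimage_emb
      e.repr.toHomeomorph.measurableEmbedding, measureReal_def]

/-- Girard's theorem. -/
theorem toSphere_real_trihedral {n : Fin 3 → E3} (h : LinearIndependent ℝ n) :
    (volume : Measure E3).toSphere.real {u | ∀ i, 0 ≤ ⟪n i, (u : E3)⟫_ℝ} =
      2 * Real.pi - angle (n 0) (n 1) - angle (n 0) (n 2) - angle (n 1) (n 2) := by
  have hpair : ∀ i j : Fin 3, i ≠ j → LinearIndependent ℝ ![n i, n j] := fun i j hij => by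
    have hinj : Function.Injective ![i, j] := by
      simp [Function.Injective, Fin.forall_fin_two, hij, hij.symm]
    have hcomp : n ∘ ![i, j] = ![n i, n j] := funext (Fin.forall_fin_two.mpr ⟨rfl, rfl⟩)
    exact hcomp ▸ h.comp _ hinj
  set K : Set E3 := {x | ∀ i, 0 ≤ ⟪n i, x⟫_ℝ} with hK
  have hKmeas : MeasurableSet K := by
    rw [hK, ofPred_forall]
    exact .iInter fun i => measurableSet_le measurable_const (by fun_prop)
  have hKsmul : ∀ c : ℝ, 0 < c → ∀ x ∈ K, c • x ∈ K := fun c hc x hx i => by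
    rw [real_inner_smul_right]
    exact mul_nonneg hc.le (hx i)
  have hKae : K =ᵐ[ballMeasure]
      (openHalfSpace (n 0) ∩ openHalfSpace (n 1) ∩ openHalfSpace (n 2) : Set E3) := by
    refine eventuallyEq_set.mpr ?_
    filter_upwards [ae_all_iff.mpr fun i => ae_ballMeasure_inner_ne_zero (h.ne_zero i)] with x hx
    simp only [hK, openHalfSpace, mem_inter_iff, mem_ofPred_eq, (hx _).symm.le_iff_lt,
      Fin.forall_fin_succ, Fin.succ_zero_eq_one, Fin.succ_one_eq_two, IsEmpty.forall_iff, and_true,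
      and_assoc]
  have hinter := measureReal_inter_openHalfSpace (fun _ => ae_ballMeasure_inner_ne_zero)
    (h.ne_zero 0) (h.ne_zero 1) (h.ne_zero 2)
  rw [ballMeasure_real_wedge (hpair 0 1 (by decide)),
    ballMeasure_real_wedge (hpair 0 2 (by decide)),
    ballMeasure_real_wedge (hpair 1 2 (by decide)), ballMeasure_real_univ] at hinter
  have hcone := toSphere_real_setOf_mem volume hKmeas hKsmul
  rw [← ballMeasure, measureReal_congr hKae, finrank_euclideanSpace_fin] at hcone
  refine hcone.trans ?_
  push_cast
  linarith

end Wedge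

section EdgeFrame

open scoped InnerProductSpace

/-- The quadratic form `descartes` is Lorentzian and, up to a factor, equal to its dual form, so it
is nonpositive on the vectors that annihilate a timelike one. -/
lemma descartes_nonpos_of_dotProduct_eq_zero {k y : Fin 4 → ℝ} (hk : 0 < descartes k)
    (h : k ⬝ᵥ y = 0) : descartes y ≤ 0 := by
  have hcs := Finset.sum_mul_sq_le_sq_mul_sq Finset.univ (fun i => 4 * k i - ∑ j, k j)
    (fun i => 4 * y i - ∑ j, y j)
  have hy : 0 ≤ ∑ i, (4 * y i - ∑ j, y j) ^ 2 := Finset.sum_nonneg fun i _ => sq_nonneg _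
  have hk0 : 0 < (∑ i, k i) ^ 2 := by
    have hsq : 0 ≤ ∑ i, k i ^ 2 := Finset.sum_nonneg fun i _ => sq_nonneg _
    rw [descartes] at hk
    linarith
  have hinner : ∑ i, (4 * k i - ∑ j, k j) * (4 * y i - ∑ j, y j) =
      -4 * ((∑ i, k i) * ∑ i, y i) := by
    rw [dotProduct] at h
    simp only [Fin.sum_univ_four] at h ⊢
    linear_combination 16 * h
  have hnorm : ∀ z : Fin 4 → ℝ,
      ∑ i, (4 * z i - ∑ j, z j) ^ 2 = 4 * ((∑ i, z i) ^ 2 - 2 * descartes z) := fun z => by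
    simp only [descartes, Fin.sum_univ_four]
    ring
  rw [hinner, hnorm, hnorm] at hcs
  rw [hnorm] at hy
  have hle : (∑ i, k i) ^ 2 * (∑ i, y i) ^ 2 ≤
      (∑ i, k i) ^ 2 * ((∑ i, y i) ^ 2 - 2 * descartes y) := by
    nlinarith [mul_nonneg hk.le hy]
  linarith [le_of_mul_le_mul_left hle hk0]

/-- The Gram matrix of the edges from the vertex `0` to the other vertices in a tetrahedron whose
edges have the lengths `r j + r m`, as given by the law of cosines. -/
def edgeGram (r : Fin 4 → ℝ) : Matrix (Fin 3) (Fin 3) ℝ :=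
  of fun j m => if j = m then (r 0 + r j.succ) ^ 2 else
    r 0 ^ 2 + r 0 * r j.succ + r 0 * r m.succ - r j.succ * r m.succ

lemma dotProduct_edgeGram_mulVec_self (r : Fin 4 → ℝ) (z : Fin 3 → ℝ) :
    z ⬝ᵥ edgeGram r *ᵥ z = -descartes (r * vecCons (-∑ j, z j) z) := by
  simp only [edgeGram, dotProduct, mulVec, descartes, of_apply, Pi.mul_apply, Fin.sum_univ_four,
    Fin.sum_univ_three, cons_val_zero, cons_val_one, cons_val, ↓reduceIte, Fin.reduceEq,
    zero_ne_one, one_ne_zero, Fin.succ_zero_eq_one, Fin.succ_one_eq_two, Fin.reduceSucc]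
  ring

lemma posSemidef_edgeGram {r : Fin 4 → ℝ} (hr : ∀ i, 0 < r i) (hQ : 0 < descartes r⁻¹) :
    (edgeGram r).PosSemidef := by
  refine posSemidef_iff_dotProduct_mulVec.mpr ⟨?_, fun z => ?_⟩
  · ext j m
    by_cases h : j = m
    · simp [edgeGram, h]
    · simp only [edgeGram, conjTranspose_apply, of_apply, if_neg h, if_neg (Ne.symm h),
        star_trivial]
      ring
  · rw [star_trivial, dotProduct_edgeGram_mulVec_self, neg_nonneg]
    refine descartes_nonpos_of_dotProduct_eq_zero hQ ?_
    have hcancel : r⁻¹ ⬝ᵥ (r * vecCons (-∑ j, z j) z) = ∑ j, vecCons (-∑ j, z j) z j :=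
      Finset.sum_congr rfl fun i _ => inv_mul_cancel_left₀ (hr i).ne' _
    rw [hcancel, Fin.sum_univ_succ, cons_val_zero]
    simp

variable {E : Type*} [NormedAddCommGroup E] [InnerProductSpace ℝ E]

/-- The vectors `a j` are the edges from the vertex `0` to the other vertices in a tetrahedron
with the radii `r`. -/
def IsEdgeFrame (r : Fin 4 → ℝ) (a : Fin 3 → E) : Prop :=
  ∀ j m, ⟪a j, a m⟫_ℝ = edgeGram r j m

open scoped MatrixOrder Matrix.Norms.L2Operator in
lemma exists_isEdgeFrame {r : Fin 4 → ℝ} (hr : ∀ i, 0 < r i) (hQ : 0 < descartes r⁻¹) :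
    ∃ a : Fin 3 → E3, IsEdgeFrame r a := by
  obtain ⟨B, hB⟩ := CStarAlgebra.nonneg_iff_eq_star_mul_self.mp
    (posSemidef_edgeGram hr hQ).nonneg
  refine ⟨fun j => WithLp.toLp 2 (B.col j), fun j m => ?_⟩
  rw [hB, EuclideanSpace.inner_toLp_toLp, star_trivial, dotProduct_comm]
  rfl

/-- Up to a factor, the adjugate of `edgeGram r`; `k` are the inverse radii. -/
def coGram (k : Fin 4 → ℝ) (j m : Fin 3) : ℝ :=
  k j.succ * k m.succ * (faceSum k j.succ * faceSum k m.succ +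
    if j = m then descartes k else -descartes k)

lemma coGram_self_pos {k : Fin 4 → ℝ} (hk : ∀ i, 0 < k i) (j : Fin 3) : 0 < coGram k j j := by
  have hj := hk j.succ
  have hE := descartes_add_faceSum_sq_pos hk j.succ
  rw [coGram, if_pos rfl]
  exact mul_pos (mul_pos hj hj) (by linarith)

/-- The inner normals of the faces at the vertex `0`. -/
def faceNormal (k : Fin 4 → ℝ) (a : Fin 3 → E) (j : Fin 3) : E := ∑ m, coGram k j m • a m

namespace IsEdgeFrame

variable {r : Fin 4 → ℝ} {a : Fin 3 → E}

lemma inner_faceNormal_edge (h : IsEdgeFrame r a) (hr : ∀ i, 0 < r i) (j m : Fin 3) :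
    ⟪faceNormal r⁻¹ a j, a m⟫_ℝ = if j = m then 4 * descartes r⁻¹ else 0 := by
  have h0 := (hr 0).ne'
  have h1 := (hr 1).ne'
  have h2 := (hr 2).ne'
  have h3 := (hr 3).ne'
  simp only [faceNormal, sum_inner, real_inner_smul_left, h _ _, edgeGram, of_apply]
  fin_cases j <;> fin_cases m <;>
    simp only [coGram, faceSum, descartes, Pi.inv_apply, Fin.sum_univ_three, Fin.sum_univ_four,
      Fin.zero_eta, Fin.mk_one, Fin.reduceFinMk, Fin.succ_zero_eq_one, Fin.succ_one_eq_two,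
      Fin.reduceSucc, Fin.reduceEq, zero_ne_one, one_ne_zero, ↓reduceIte] <;>
    field_simp <;> ring

lemma inner_faceNormal_sum (h : IsEdgeFrame r a) (hr : ∀ i, 0 < r i) (j : Fin 3) (c : Fin 3 → ℝ) :
    ⟪faceNormal r⁻¹ a j, ∑ m, c m • a m⟫_ℝ = c j * (4 * descartes r⁻¹) := by
  simp only [inner_sum, real_inner_smul_right, h.inner_faceNormal_edge hr, mul_ite, mul_zero,
    Finset.sum_ite_eq, Finset.mem_univ, if_true]

lemma inner_faceNormal_faceNormal (h : IsEdgeFrame r a) (hr : ∀ i, 0 < r i) (j m : Fin 3) :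
    ⟪faceNormal r⁻¹ a j, faceNormal r⁻¹ a m⟫_ℝ = coGram r⁻¹ m j * (4 * descartes r⁻¹) :=
  h.inner_faceNormal_sum hr j _

lemma descartes_pos (h : IsEdgeFrame r a) (hr : ∀ i, 0 < r i) (ha : LinearIndependent ℝ a) :
    0 < descartes r⁻¹ := by
  have hM := coGram_self_pos (fun i => inv_pos.mpr (hr i) : ∀ i, 0 < r⁻¹ i) 0
  have hne : faceNormal r⁻¹ a 0 ≠ 0 := fun h0 =>
    hM.ne' (Fintype.linearIndependent_iff.mp ha _ h0 0)
  have hpos := real_inner_self_pos.mpr hne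
  rw [h.inner_faceNormal_faceNormal hr] at hpos
  linarith [pos_of_mul_pos_right hpos hM.le]

lemma linearIndependent (h : IsEdgeFrame r a) (hr : ∀ i, 0 < r i) (hQ : 0 < descartes r⁻¹) :
    LinearIndependent ℝ a := by
  refine Fintype.linearIndependent_iff.mpr fun c hc j => ?_
  have hinner := h.inner_faceNormal_sum hr j c
  rw [hc, inner_zero_right] at hinner
  exact (mul_eq_zero.mp hinner.symm).resolve_right (by positivity)

lemma linearIndependent_faceNormal (h : IsEdgeFrame r a) (hr : ∀ i, 0 < r i)
    (hQ : 0 < descartes r⁻¹) : LinearIndependent ℝ (faceNormal r⁻¹ a) := by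
  refine Fintype.linearIndependent_iff.mpr fun c hc j => ?_
  have hinner : ⟪∑ m, c m • faceNormal r⁻¹ a m, a j⟫_ℝ = c j * (4 * descartes r⁻¹) := by
    simp only [sum_inner, real_inner_smul_left, h.inner_faceNormal_edge hr, mul_ite, mul_zero,
      Finset.sum_ite_eq', Finset.mem_univ, if_true]
  rw [hc, inner_zero_left] at hinner
  exact (mul_eq_zero.mp hinner.symm).resolve_right (by positivity)

lemma norm_faceNormal (h : IsEdgeFrame r a) (hr : ∀ i, 0 < r i) (hQ : 0 ≤ descartes r⁻¹)
    (j : Fin 3) : ‖faceNormal r⁻¹ a j‖ = 2 * √(descartes r⁻¹) * r⁻¹ j.succ *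
      √(descartes r⁻¹ + faceSum r⁻¹ j.succ ^ 2) := by
  have hk : ∀ i, 0 < r⁻¹ i := fun i => inv_pos.mpr (hr i)
  have hE := (descartes_add_faceSum_sq_pos hk j.succ).le
  have hj := (hk j.succ).le
  rw [norm_eq_sqrt_real_inner, h.inner_faceNormal_faceNormal hr, Real.sqrt_eq_iff_eq_sq
    (mul_nonneg (coGram_self_pos hk j).le (by positivity)) (by positivity)]
  simp only [mul_pow, Real.sq_sqrt hQ, Real.sq_sqrt hE, coGram, if_true]
  ring

end IsEdgeFrame

variable {k : Fin 4 → ℝ}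

lemma sin_faceAngle (hQ : 0 < descartes k) (j : Fin 4) :
    Real.sin (faceAngle k j) = faceSum k j / √(descartes k + faceSum k j ^ 2) := by
  have hE := Real.sqrt_pos.mpr (by positivity : 0 < descartes k + faceSum k j ^ 2)
  have habs : |faceSum k j| ≤ √(descartes k + faceSum k j ^ 2) :=
    Real.abs_le_sqrt (by linarith)
  obtain ⟨hlow, hup⟩ := abs_le.mp habs
  exact Real.sin_arcsin ((le_div_iff₀ hE).mpr (by linarith)) ((div_le_one hE).mpr hup)

lemma cos_faceAngle (hQ : 0 < descartes k) (j : Fin 4) :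
    Real.cos (faceAngle k j) = √(descartes k) / √(descartes k + faceSum k j ^ 2) := by
  have hE : 0 < descartes k + faceSum k j ^ 2 := by positivity
  rw [faceAngle, Real.cos_arcsin, ← Real.sqrt_div hQ.le, div_pow, Real.sq_sqrt hE.le]
  congr 1
  field_simp
  ring

lemma faceAngle_add_nonneg (hk : ∀ i, 0 < k i) (hQ : 0 < descartes k) {i j : Fin 4}
    (hij : i ≠ j) : 0 ≤ faceAngle k i + faceAngle k j := by
  have hP : 0 ≤ faceSum k i + faceSum k j := by
    have h : k i + k j ≤ ∑ m, k m := by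
      rw [← Finset.sum_pair hij]
      exact Finset.sum_le_univ_sum_of_nonneg fun m => (hk m).le
    simp only [faceSum]
    linarith
  rw [faceAngle_eq_arctan hQ, faceAngle_eq_arctan hQ, ← neg_le_iff_add_nonneg, ← Real.arctan_neg,
    Real.arctan_le_arctan_iff, ← neg_div]
  exact div_le_div_of_nonneg_right (by linarith) (Real.sqrt_nonneg _)

lemma faceAngle_add_le (k : Fin 4 → ℝ) (i j : Fin 4) : faceAngle k i + faceAngle k j ≤ Real.pi := by
  have hi : faceAngle k i ≤ Real.pi / 2 := Real.arcsin_le_pi_div_two _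
  have hj : faceAngle k j ≤ Real.pi / 2 := Real.arcsin_le_pi_div_two _
  linarith

namespace IsEdgeFrame

variable {r : Fin 4 → ℝ}

/-- The dihedral angle at an edge is the sum of the two face angles at that edge. -/
lemma angle_faceNormal {a : Fin 3 → E} (h : IsEdgeFrame r a) (hr : ∀ i, 0 < r i)
    (hQ : 0 < descartes r⁻¹) {j m : Fin 3} (hjm : j ≠ m) :
    InnerProductGeometry.angle (faceNormal r⁻¹ a j) (faceNormal r⁻¹ a m) =
      Real.pi - (faceAngle r⁻¹ j.succ + faceAngle r⁻¹ m.succ) := by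
  have hk : ∀ i, 0 < r⁻¹ i := fun i => inv_pos.mpr (hr i)
  have hne : j.succ ≠ m.succ := fun e => hjm (Fin.succ_injective _ e)
  have hcos : Real.cos (Real.pi - (faceAngle r⁻¹ j.succ + faceAngle r⁻¹ m.succ)) =
      ⟪faceNormal r⁻¹ a j, faceNormal r⁻¹ a m⟫_ℝ /
        (‖faceNormal r⁻¹ a j‖ * ‖faceNormal r⁻¹ a m‖) := by
    rw [h.norm_faceNormal hr hQ.le, h.norm_faceNormal hr hQ.le, h.inner_faceNormal_faceNormal hr,
      coGram, if_neg hjm.symm, Real.cos_pi_sub, Real.cos_add, sin_faceAngle hQ, sin_faceAngle hQ,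
      cos_faceAngle hQ, cos_faceAngle hQ]
    have hEj := Real.sqrt_pos.mpr (descartes_add_faceSum_sq_pos hk j.succ)
    have hEm := Real.sqrt_pos.mpr (descartes_add_faceSum_sq_pos hk m.succ)
    have hs := Real.sqrt_pos.mpr hQ
    have hs2 := Real.sq_sqrt hQ.le
    have hkj := hk j.succ
    have hkm := hk m.succ
    set s := √(descartes r⁻¹)
    rw [← hs2] at hEj hEm ⊢
    field_simp
    ring
  rw [InnerProductGeometry.angle, ← hcos, Real.arccos_cos]
  · linarith [faceAngle_add_le r⁻¹ j.succ m.succ]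
  · linarith [faceAngle_add_nonneg hk hQ hne]

lemma sum_smul_nonneg_iff {a : Fin 3 → E3} (h : IsEdgeFrame r a) (hr : ∀ i, 0 < r i)
    (hQ : 0 < descartes r⁻¹) (x : E3) :
    (∃ c : Fin 3 → ℝ, (∀ j, 0 ≤ c j) ∧ x = ∑ j, c j • a j) ↔
      ∀ j, 0 ≤ ⟪faceNormal r⁻¹ a j, x⟫_ℝ := by
  have hQ4 : 0 < 4 * descartes r⁻¹ := by positivity
  constructor
  · rintro ⟨c, hc, rfl⟩ j
    rw [h.inner_faceNormal_sum hr]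
    exact mul_nonneg (hc j) hQ4.le
  · intro hx
    have hspan : x ∈ Submodule.span ℝ (range a) := by
      rw [(h.linearIndependent hr hQ).span_eq_top_of_card_eq_finrank (by simp)]
      exact Submodule.mem_top
    obtain ⟨c, rfl⟩ := (Submodule.mem_span_range_iff_exists_fun ℝ).mp hspan
    refine ⟨c, fun j => ?_, rfl⟩
    have hj := hx j
    rw [h.inner_faceNormal_sum hr] at hj
    exact nonneg_of_mul_nonneg_left hj hQ4

theorem toSphere_real_cone {a : Fin 3 → E3} (h : IsEdgeFrame r a) (hr : ∀ i, 0 < r i)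
    (hQ : 0 < descartes r⁻¹) :
    (volume : Measure E3).toSphere.real
      {u | ∃ c : Fin 3 → ℝ, (∀ j, 0 ≤ c j) ∧ (u : E3) = ∑ j, c j • a j} = vertexAngle r 0 := by
  simp only [h.sum_smul_nonneg_iff hr hQ]
  rw [toSphere_real_trihedral (h.linearIndependent_faceNormal hr hQ),
    h.angle_faceNormal hr hQ (by decide), h.angle_faceNormal hr hQ (by decide),
    h.angle_faceNormal hr hQ (by decide)]
  simp only [vertexAngle, Fin.sum_univ_four, Fin.succ_zero_eq_one, Fin.succ_one_eq_two,
    Fin.reduceSucc]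
  ring

end IsEdgeFrame

end EdgeFrame

section TetrahedronAngles

open scoped InnerProductSpace

lemma isEdgeFrame_iff_norm {E : Type*} [NormedAddCommGroup E] [InnerProductSpace ℝ E]
    {r : Fin 4 → ℝ} (hr : ∀ i, 0 < r i) {a : Fin 3 → E} :
    IsEdgeFrame r a ↔ (∀ j, ‖a j‖ = r 0 + r j.succ) ∧
      ∀ j m, j ≠ m → ‖a j - a m‖ = r j.succ + r m.succ := by
  have hpos : ∀ i m, 0 ≤ r i + r m := fun i m => (add_pos (hr i) (hr m)).le
  constructor
  · intro h
    have hnorm : ∀ j, ‖a j‖ = r 0 + r j.succ := fun j => by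
      rw [← sq_eq_sq₀ (norm_nonneg _) (hpos _ _), ← real_inner_self_eq_norm_sq, h]
      simp [edgeGram]
    refine ⟨hnorm, fun j m hjm => ?_⟩
    rw [← sq_eq_sq₀ (norm_nonneg _) (hpos _ _), norm_sub_sq_real, h, hnorm, hnorm]
    simp only [edgeGram, of_apply, if_neg hjm]
    ring
  · rintro ⟨hnorm, hdiff⟩ j m
    by_cases hjm : j = m
    · simp [hjm, edgeGram, hnorm]
    · rw [real_inner_eq_norm_mul_self_add_norm_mul_self_sub_norm_sub_mul_self_div_two, hnorm,
        hnorm, hdiff j m hjm]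
      simp only [edgeGram, of_apply, if_neg hjm]
      ring

/-- The edges from the point with the index `0` to the others. -/
def edgesAtZero (q : Fin 4 → E3) (j : Fin 3) : E3 := q j.succ - q 0

lemma isEdgeFrame_edgesAtZero_iff {r : Fin 4 → ℝ} (hr : ∀ i, 0 < r i) {q : Fin 4 → E3} :
    IsEdgeFrame r (edgesAtZero q) ↔ ∀ i m, i ≠ m → dist (q i) (q m) = r i + r m := by
  simp only [isEdgeFrame_iff_norm hr, edgesAtZero, sub_sub_sub_cancel_right, ← dist_eq_norm]
  constructor
  · rintro ⟨hnorm, hdiff⟩ i m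
    cases i using Fin.cases <;> cases m using Fin.cases
    · exact fun h => absurd rfl h
    · exact fun _ => by rw [dist_comm, hnorm]
    · exact fun _ => by rw [hnorm, add_comm]
    · exact fun h => hdiff _ _ fun e => h (congrArg Fin.succ e)
  · intro h
    exact ⟨fun j => by rw [h _ _ (Fin.succ_ne_zero j), add_comm],
      fun j m hjm => h _ _ fun e => hjm (Fin.succ_injective _ e)⟩

lemma affineIndependent_iff_linearIndependent_edgesAtZero {q : Fin 4 → E3} :
    AffineIndependent ℝ q ↔ LinearIndependent ℝ (edgesAtZero q) := by
  rw [affineIndependent_iff_linearIndependent_vsub ℝ _ (0 : Fin 4),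
    ← linearIndependent_equiv (finSuccAboveEquiv (0 : Fin 4))]
  rfl

variable {V : Type*} {e : Fin 4 ↪ V} {r : V → ℝ}

lemma exists_map_univ_eq {τ : Finset V} (hτ : τ.card = 4) :
    ∃ e : Fin 4 ↪ V, Finset.univ.map e = τ := by
  refine ⟨(Finset.equivFinOfCardEq hτ).symm.toEmbedding.trans (Function.Embedding.subtype _), ?_⟩
  rw [← Finset.map_map, Finset.map_univ_equiv, Finset.univ_eq_attach, Finset.attach_map_val]

lemma isRealization_map_iff {p : V → E3} (hr : ∀ i, 0 < r i) :
    IsRealization (Finset.univ.map e) r p ↔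
      LinearIndependent ℝ (edgesAtZero (p ∘ e)) ∧ IsEdgeFrame (r ∘ e) (edgesAtZero (p ∘ e)) := by
  refine and_congr ?_ ?_
  · rw [← affineIndependent_iff_linearIndependent_edgesAtZero, ← affineIndependent_equiv
      ((Equiv.subtypeUnivEquiv Finset.mem_univ).symm.trans (Finset.equivMap e Finset.univ))]
    rfl
  · simp only [isEdgeFrame_edgesAtZero_iff (r := r ∘ e) fun i => hr (e i), Finset.forall_mem_map,
      Finset.mem_univ, true_imp_iff, e.injective.ne_iff, Function.comp_apply]

lemma exists_isRealization_map_iff (hr : ∀ i, 0 < r i) :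
    (∃ p : V → E3, IsRealization (Finset.univ.map e) r p) ↔ 0 < descartes (r ∘ e)⁻¹ := by
  simp only [isRealization_map_iff hr]
  constructor
  · rintro ⟨p, hli, hframe⟩
    exact hframe.descartes_pos (fun i => hr _) hli
  · intro hQ
    obtain ⟨a, ha⟩ := exists_isEdgeFrame (r := r ∘ e) (fun i => hr _) hQ
    have hedges : edgesAtZero (Function.extend e (Fin.cons 0 a : Fin 4 → E3) 0 ∘ e) = a := by
      rw [Function.extend_comp e.injective]
      funext j
      simp [edgesAtZero]
    exact ⟨_, hedges.symm ▸ ha.linearIndependent (fun i => hr _) hQ, hedges.symm ▸ ha⟩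

lemma mem_vertexCone_map_iff {p : V → E3} {x : E3} :
    x ∈ vertexCone (Finset.univ.map e) p (e 0) ↔
      ∃ c : Fin 3 → ℝ, (∀ j, 0 ≤ c j) ∧ x = ∑ j, c j • edgesAtZero (p ∘ e) j := by
  have hsum : ∀ c : V → ℝ, ∑ j ∈ Finset.univ.map e, c j • (p j - p (e 0)) =
      ∑ j, c (e j.succ) • edgesAtZero (p ∘ e) j := fun c => by
    rw [Finset.sum_map, Fin.sum_univ_succ, sub_self, smul_zero, zero_add]
    rfl
  simp only [vertexCone, mem_ofPred_eq, hsum]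
  constructor
  · rintro ⟨c, hc, hx⟩
    exact ⟨fun j => c (e j.succ), fun j => hc _, hx⟩
  · rintro ⟨c, hc, hx⟩
    have hcons : 0 ≤ (Fin.cons 0 c : Fin 4 → ℝ) := fun i => by cases i using Fin.cases <;> simp [hc]
    refine ⟨Function.extend e (Fin.cons 0 c : Fin 4 → ℝ) 0,
      fun j => Function.extend_nonneg hcons le_rfl j, ?_⟩
    simpa only [e.injective.extend_apply, Fin.cons_succ] using hx

/-- The positive vectors of radii for which the tetrahedron `τ` exists. -/
def realizableRadii (τ : Finset V) : Set (V → ℝ) :=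
  {r | (∀ i, 0 < r i) ∧ ∃ p : V → E3, IsRealization τ r p}

lemma mem_realizableRadii_map_iff :
    r ∈ realizableRadii (Finset.univ.map e) ↔ (∀ i, 0 < r i) ∧ 0 < descartes (r ∘ e)⁻¹ :=
  and_congr_right exists_isRealization_map_iff

lemma solidAngle_map_zero (h : r ∈ realizableRadii (Finset.univ.map e)) :
    solidAngle (Finset.univ.map e) r (e 0) = vertexAngle (r ∘ e) 0 := by
  have hQ := (mem_realizableRadii_map_iff.mp h).2
  have hframe := ((isRealization_map_iff h.1).mp h.2.choose_spec).2
  simp only [solidAngle, dif_pos h.2, solidAngleAt, mem_vertexCone_map_iff]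
  exact hframe.toSphere_real_cone (fun i => h.1 _) hQ

lemma solidAngle_map (h : r ∈ realizableRadii (Finset.univ.map e)) (i : Fin 4) :
    solidAngle (Finset.univ.map e) r (e i) = vertexAngle (r ∘ e) i := by
  set e' : Fin 4 ↪ V := (Equiv.swap 0 i).toEmbedding.trans e
  have hmap : Finset.univ.map e = Finset.univ.map e' := by
    rw [← Finset.map_map, Finset.map_univ_equiv]
  have hi : e i = e' 0 := congrArg e (Equiv.swap_apply_left 0 i).symm
  rw [hmap] at h ⊢
  rw [hi, solidAngle_map_zero h]
  exact (vertexAngle_comp_perm (r ∘ e) (Equiv.swap 0 i) 0).trans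
    (congrArg _ (Equiv.swap_apply_left 0 i))

lemma sum_solidAngle_map_mul (h : r ∈ realizableRadii (Finset.univ.map e)) (w : V → ℝ) :
    ∑ j ∈ Finset.univ.map e, solidAngle (Finset.univ.map e) r j * w j =
      vertexAngle (r ∘ e) ⬝ᵥ (w ∘ e) := by
  simp only [Finset.sum_map, solidAngle_map h, dotProduct, Function.comp_apply]

lemma solidAngle_le (τ : Finset V) (r : V → ℝ) (i : V) :
    solidAngle τ r i ≤ (volume : Measure E3).toSphere.real univ := by
  rw [solidAngle]
  split_ifs
  · exact measureReal_mono (subset_univ _)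
  · exact measureReal_nonneg

variable {τ : Finset V} {r' : V → ℝ}

lemma one_mem_realizableRadii (hτ : τ.card = 4) : 1 ∈ realizableRadii τ := by
  obtain ⟨e, rfl⟩ := exists_map_univ_eq hτ
  refine mem_realizableRadii_map_iff.mpr ⟨fun _ => zero_lt_one, ?_⟩
  norm_num [descartes]

lemma smul_mem_realizableRadii (hτ : τ.card = 4) (h : r ∈ realizableRadii τ) {c : ℝ}
    (hc : 0 < c) : c • r ∈ realizableRadii τ := by
  obtain ⟨e, rfl⟩ := exists_map_univ_eq hτ
  rw [mem_realizableRadii_map_iff] at h ⊢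
  have hinv : ((c • r) ∘ e)⁻¹ = c⁻¹ • (r ∘ e)⁻¹ := funext fun i => mul_inv c (r (e i))
  refine ⟨fun i => mul_pos hc (h.1 i), ?_⟩
  rw [hinv, descartes_smul]
  exact mul_pos (pow_pos (inv_pos.mpr hc) 2) h.2

lemma solidAngle_smul (hτ : τ.card = 4) (h : r ∈ realizableRadii τ) {c : ℝ} (hc : 0 < c) {j : V}
    (hj : j ∈ τ) : solidAngle τ (c • r) j = solidAngle τ r j := by
  have hcr := smul_mem_realizableRadii hτ h hc
  obtain ⟨e, rfl⟩ := exists_map_univ_eq hτ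
  obtain ⟨i, -, rfl⟩ := Finset.mem_map.mp hj
  rw [solidAngle_map h, solidAngle_map hcr]
  exact congrFun (vertexAngle_smul hc (r ∘ e)) i

lemma sum_solidAngle_sub_mul_map (h : r ∈ realizableRadii (Finset.univ.map e))
    (h' : r' ∈ realizableRadii (Finset.univ.map e)) :
    ∑ j ∈ Finset.univ.map e,
        (solidAngle (Finset.univ.map e) r' j - solidAngle (Finset.univ.map e) r j) *
          (r' j - r j) =
      (vertexAngle (r' ∘ e) - vertexAngle (r ∘ e)) ⬝ᵥ (r' ∘ e - r ∘ e) := by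
  simp only [Finset.sum_map, solidAngle_map h, solidAngle_map h', dotProduct, Pi.sub_apply,
    Function.comp_apply]

theorem sum_solidAngle_sub_mul_nonpos (hτ : τ.card = 4) (h : r ∈ realizableRadii τ)
    (h' : r' ∈ realizableRadii τ) :
    ∑ j ∈ τ, (solidAngle τ r' j - solidAngle τ r j) * (r' j - r j) ≤ 0 := by
  obtain ⟨e, rfl⟩ := exists_map_univ_eq hτ
  rw [sum_solidAngle_sub_mul_map h h']
  exact vertexAngle_sub_dotProduct_sub_nonpos (fun i => h.1 _) (fun i => h'.1 _)

theorem exists_eq_mul_of_sum_solidAngle_sub_mul_eq_zero (hτ : τ.card = 4)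
    (h : r ∈ realizableRadii τ) (h' : r' ∈ realizableRadii τ)
    (h0 : ∑ j ∈ τ, (solidAngle τ r' j - solidAngle τ r j) * (r' j - r j) = 0) :
    ∃ c : ℝ, ∀ j ∈ τ, r' j = c * r j := by
  obtain ⟨e, rfl⟩ := exists_map_univ_eq hτ
  rw [sum_solidAngle_sub_mul_map h h'] at h0
  obtain ⟨c, hc⟩ := eq_smul_of_vertexAngle_sub_dotProduct_sub_eq_zero (fun i => h.1 _)
    (fun i => h'.1 _) (mem_realizableRadii_map_iff.mp h).2 h0
  refine ⟨c, fun j hj => ?_⟩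
  obtain ⟨i, -, rfl⟩ := Finset.mem_map.mp hj
  exact congrFun hc i

lemma isOpen_realizableRadii [Finite V] (hτ : τ.card = 4) : IsOpen (realizableRadii τ) := by
  obtain ⟨e, rfl⟩ := exists_map_univ_eq hτ
  refine isOpen_iff_mem_nhds.mpr fun r h => ?_
  rw [mem_realizableRadii_map_iff] at h
  have hinv : ContinuousAt (fun r : V → ℝ => (r ∘ e)⁻¹) r :=
    continuousAt_pi.mpr fun i => (continuous_apply (e i)).continuousAt.inv₀ (h.1 _).ne'
  filter_upwards [eventually_all.mpr fun i : V =>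
      (continuous_apply i).continuousAt.eventually (lt_mem_nhds (h.1 i)),
    (continuous_descartes.continuousAt.comp hinv).eventually (lt_mem_nhds h.2)] with r' h1 h2
  exact mem_realizableRadii_map_iff.mpr ⟨h1, h2⟩

lemma differentiableAt_solidAngle [Finite V] (hτ : τ.card = 4) (h : r ∈ realizableRadii τ)
    {j : V} (hj : j ∈ τ) : DifferentiableAt ℝ (fun x => solidAngle τ x j) r := by
  cases nonempty_fintype V
  have hnhds := (isOpen_realizableRadii hτ).mem_nhds h
  obtain ⟨e, rfl⟩ := exists_map_univ_eq hτ
  obtain ⟨i, -, rfl⟩ := Finset.mem_map.mp hj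
  have hd : DifferentiableAt ℝ vertexAngle (r ∘ e) :=
    (hasFDerivAt_vertexAngle (fun i => h.1 _)
      (mem_realizableRadii_map_iff.mp h).2).differentiableAt
  have hcomp : DifferentiableAt ℝ (fun x : V → ℝ => vertexAngle (x ∘ e)) r :=
    hd.comp (f := fun x : V → ℝ => x ∘ e) r (by unfold Function.comp; fun_prop)
  refine (differentiableAt_pi.mp hcomp i).congr_of_eventuallyEq ?_
  filter_upwards [hnhds] with x hx
  exact solidAngle_map hx i

theorem hasFDerivAt_sum_solidAngle_mul_self [Finite V] (hτ : τ.card = 4)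
    (h : r ∈ realizableRadii τ) :
    HasFDerivAt (fun x => ∑ j ∈ τ, solidAngle τ x j * r j) (0 : (V → ℝ) →L[ℝ] ℝ) r := by
  cases nonempty_fintype V
  have hnhds := (isOpen_realizableRadii hτ).mem_nhds h
  obtain ⟨e, rfl⟩ := exists_map_univ_eq hτ
  have hschlafli := hasFDerivAt_vertexAngle_dotProduct_self (r := r ∘ e) (fun i => h.1 _)
    (mem_realizableRadii_map_iff.mp h).2
  have hcomp := hschlafli.comp (f := fun x : V → ℝ => x ∘ e) r
    (DifferentiableAt.hasFDerivAt (by unfold Function.comp; fun_prop))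
  rw [ContinuousLinearMap.zero_comp] at hcomp
  refine hcomp.congr_of_eventuallyEq ?_
  filter_upwards [hnhds] with x hx
  exact sum_solidAngle_map_mul hx r

end TetrahedronAngles

section Connected

variable {V : Type*} [Fintype V] {tets : Finset (Finset V)}

open Classical in
lemma sum_filter_eq_zero_or_one_of_mem_geomRealization {P : V → Prop}
    (hP : ∀ τ ∈ tets, ∀ i ∈ τ, ∀ j ∈ τ, P i → P j) {x : V → ℝ} (hx : x ∈ geomRealization tets) :
    ∑ i with P i, x i = 0 ∨ ∑ i with P i, x i = 1 := by
  obtain ⟨-, hsum, τ, hτ, hsupp⟩ := hx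
  by_cases hv : ∃ i ∈ τ, P i
  · obtain ⟨i, hi, hPi⟩ := hv
    refine Or.inr ((Finset.sum_filter_of_ne fun j _ hj => ?_).trans hsum)
    exact hP τ hτ i hi j (not_imp_comm.mp (hsupp j) hj) hPi
  · refine Or.inl (Finset.sum_eq_zero fun j hj => hsupp j fun hjτ => hv ⟨j, hjτ, ?_⟩)
    exact (Finset.mem_filter.mp hj).2

open Classical in
lemma single_mem_geomRealization {τ : Finset V} (hτ : τ ∈ tets) {v : V} (hv : v ∈ τ) :
    Pi.single v (1 : ℝ) ∈ geomRealization tets :=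
  ⟨fun i => (Pi.single_nonneg.mpr zero_le_one : (0 : V → ℝ) ≤ Pi.single v 1) i, by simp, τ, hτ,
    fun _ hi => Pi.single_eq_of_ne (ne_of_mem_of_not_mem hv hi).symm _⟩

/-- The total weight of the coordinates at the vertices where `g` has a given value takes only the
values `0` and `1`, so it is constant on a connected realization. -/
theorem eq_of_connected_geomRealization [ConnectedSpace (geomRealization tets)] {A : Type*}
    {g : V → A} (hg : ∀ τ ∈ tets, ∀ i ∈ τ, ∀ j ∈ τ, g i = g j) {σ τ : Finset V} (hσ : σ ∈ tets)
    (hτ : τ ∈ tets) {v w : V} (hv : v ∈ σ) (hw : w ∈ τ) : g v = g w := by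
  classical
  by_contra hne
  let weight : geomRealization tets → ℝ := fun x => ∑ i with g i = g v, (x : V → ℝ) i
  have hcont : Continuous weight := by fun_prop
  have hweight_v : weight ⟨_, single_mem_geomRealization hσ hv⟩ = 1 := by
    simp [weight]
  have hweight_w : weight ⟨_, single_mem_geomRealization hτ hw⟩ = 0 := by
    simp [weight, Ne.symm hne]
  obtain ⟨x, hx⟩ := mem_range_of_exists_le_of_exists_ge (c := (1 / 2 : ℝ)) hcont
    ⟨_, hweight_w.trans_le (by norm_num)⟩ ⟨_, le_of_le_of_eq (by norm_num) hweight_v.symm⟩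
  have h01 := sum_filter_eq_zero_or_one_of_mem_geomRealization (P := fun i => g i = g v)
    (fun τ hτ i hi j hj h => (hg τ hτ j hj i hi).trans h) x.2
  rcases h01 with h | h <;> norm_num [weight, h] at hx

end Connected

namespace Triangulation

variable {M : Type*} [TopologicalSpace M] {V : Type*} [Fintype V] (T : Triangulation M V)
  {r r' : V → ℝ}

include T in
lemma nonempty_vertices [Nonempty M] : Nonempty V := by
  obtain ⟨-, -, -, τ, hτ, -⟩ := T.homeo.symm (Classical.arbitrary M)
  obtain ⟨v, -⟩ : τ.Nonempty := Finset.card_pos.mp (by rw [T.card_tet τ hτ]; norm_num)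
  exact ⟨v⟩

theorem eq_of_forall_mem_tets [ConnectedSpace M] {A : Type*} {g : V → A}
    (hg : ∀ τ ∈ T.tets, ∀ i ∈ τ, ∀ j ∈ τ, g i = g j) (v w : V) : g v = g w := by
  have : ConnectedSpace (geomRealization T.tets) :=
    T.homeo.symm.surjective.connectedSpace T.homeo.symm.continuous
  obtain ⟨σ, hσ, hv⟩ := T.exists_tet v
  obtain ⟨τ, hτ, hw⟩ := T.exists_tet w
  exact eq_of_connected_geomRealization hg hσ hτ hv hw

variable {T}

lemma mem_realizableRadii (h : r ∈ T.ballPackings) {τ : Finset V} (hτ : τ ∈ T.tets) :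
    r ∈ realizableRadii τ := ⟨h.1, h.2 τ hτ⟩

lemma sum_pos_of_mem_ballPackings [Nonempty V] (h : r ∈ T.ballPackings) : 0 < ∑ i, r i :=
  Finset.sum_pos (fun i _ => h.1 i) Finset.univ_nonempty

variable (T) in
lemma isOpen_ballPackings : IsOpen T.ballPackings := by
  have heq : T.ballPackings = (⋂ i, {r : V → ℝ | 0 < r i}) ∩ ⋂ τ ∈ T.tets, realizableRadii τ := by
    ext r
    simp only [ballPackings, realizableRadii, mem_inter_iff, mem_iInter, mem_ofPred_eq]
    exact and_congr_right fun hr => forall₂_congr fun τ _ => (and_iff_right hr).symm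
  rw [heq]
  refine (isOpen_iInter_of_finite fun i => isOpen_lt continuous_const (continuous_apply i)).inter ?_
  exact isOpen_biInter_finset fun τ hτ => isOpen_realizableRadii (T.card_tet τ hτ)

variable (T) in
lemma one_mem_ballPackings : 1 ∈ T.ballPackings :=
  ⟨fun _ => zero_lt_one, fun τ hτ => (one_mem_realizableRadii (T.card_tet τ hτ)).2⟩

lemma smul_mem_ballPackings (h : r ∈ T.ballPackings) {c : ℝ} (hc : 0 < c) :
    c • r ∈ T.ballPackings :=
  ⟨fun i => mul_pos hc (h.1 i), fun τ hτ =>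
    (smul_mem_realizableRadii (T.card_tet τ hτ) (mem_realizableRadii h hτ) hc).2⟩

lemma curvature_smul (h : r ∈ T.ballPackings) {c : ℝ} (hc : 0 < c) :
    T.curvature (c • r) = T.curvature r := by
  classical
  refine funext fun i => congrArg _ (Finset.sum_congr (by congr) fun τ hτ => ?_)
  rw [Finset.mem_filter] at hτ
  exact solidAngle_smul (T.card_tet τ hτ.1) (mem_realizableRadii h hτ.1) hc hτ.2

variable (T) in
lemma curvature_dotProduct (r w : V → ℝ) :
    T.curvature r ⬝ᵥ w =
      4 * Real.pi * ∑ i, w i - ∑ τ ∈ T.tets, ∑ j ∈ τ, solidAngle τ r j * w j := by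
  simp only [dotProduct, curvature, sub_mul, Finset.sum_sub_distrib, Finset.sum_mul,
    Finset.mul_sum]
  rw [Finset.sum_comm' (t' := T.tets) (s' := fun τ => τ) fun i τ => by simp [and_comm]]

variable (T) in
lemma curvature_sub_dotProduct (r r' w : V → ℝ) :
    (T.curvature r' - T.curvature r) ⬝ᵥ w =
      -∑ τ ∈ T.tets, ∑ j ∈ τ, (solidAngle τ r' j - solidAngle τ r j) * w j := by
  rw [sub_dotProduct, curvature_dotProduct, curvature_dotProduct]
  simp only [sub_mul, Finset.sum_sub_distrib]
  ring

theorem curvature_sub_dotProduct_sub_nonneg (h : r ∈ T.ballPackings) (h' : r' ∈ T.ballPackings) :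
    0 ≤ (T.curvature r' - T.curvature r) ⬝ᵥ (r' - r) := by
  rw [curvature_sub_dotProduct, neg_nonneg]
  exact Finset.sum_nonpos fun τ hτ => sum_solidAngle_sub_mul_nonpos (T.card_tet τ hτ)
    (mem_realizableRadii h hτ) (mem_realizableRadii h' hτ)

lemma exists_eq_mul_of_curvature_eq (h : r ∈ T.ballPackings) (h' : r' ∈ T.ballPackings)
    (hK : T.curvature r' = T.curvature r) {τ : Finset V} (hτ : τ ∈ T.tets) :
    ∃ c : ℝ, ∀ j ∈ τ, r' j = c * r j := by
  have h0 := T.curvature_sub_dotProduct r r' (r' - r)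
  rw [hK, sub_self, zero_dotProduct, zero_eq_neg] at h0
  have hterm := (Finset.sum_eq_zero_iff_of_nonpos fun τ hτ => sum_solidAngle_sub_mul_nonpos
    (T.card_tet τ hτ) (mem_realizableRadii h hτ) (mem_realizableRadii h' hτ)).mp h0 τ hτ
  exact exists_eq_mul_of_sum_solidAngle_sub_mul_eq_zero (T.card_tet τ hτ)
    (mem_realizableRadii h hτ) (mem_realizableRadii h' hτ) hterm

theorem exists_eq_smul_of_curvature_eq [ConnectedSpace M] (h : r ∈ T.ballPackings)
    (h' : r' ∈ T.ballPackings) (hK : T.curvature r' = T.curvature r) :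
    ∃ c : ℝ, 0 < c ∧ r' = c • r := by
  obtain ⟨v⟩ := T.nonempty_vertices
  have hratio := T.eq_of_forall_mem_tets (g := fun i => r' i / r i) fun τ hτ i hi j hj => by
    obtain ⟨c, hc⟩ := exists_eq_mul_of_curvature_eq h h' hK hτ
    rw [hc i hi, hc j hj, mul_div_cancel_right₀ _ (h.1 i).ne', mul_div_cancel_right₀ _ (h.1 j).ne']
  refine ⟨r' v / r v, div_pos (h'.1 v) (h.1 v), funext fun i => ?_⟩
  rw [Pi.smul_apply, smul_eq_mul, ← hratio i v, div_mul_cancel₀ _ (h.1 i).ne']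

lemma differentiableAt_curvature (h : r ∈ T.ballPackings) :
    DifferentiableAt ℝ T.curvature r := by
  classical
  refine differentiableAt_pi.mpr fun i =>
    (differentiableAt_const _).sub (DifferentiableAt.fun_sum fun τ hτ => ?_)
  rw [Finset.mem_filter] at hτ
  exact differentiableAt_solidAngle (T.card_tet τ hτ.1) (mem_realizableRadii h hτ.1) hτ.2

lemma hasFDerivAt_curvature_dotProduct_self (h : r ∈ T.ballPackings) :
    HasFDerivAt (fun x => T.curvature x ⬝ᵥ r) (0 : (V → ℝ) →L[ℝ] ℝ) r := by
  simp only [T.curvature_dotProduct]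
  simpa using (HasFDerivAt.fun_sum fun τ (hτ : τ ∈ T.tets) =>
    hasFDerivAt_sum_solidAngle_mul_self (T.card_tet τ hτ)
      (mem_realizableRadii h hτ)).const_sub (4 * Real.pi * ∑ i, r i)

lemma hasFDerivAt_curvature_dotProduct (h : r ∈ T.ballPackings) :
    HasFDerivAt (fun x => T.curvature x ⬝ᵥ x)
      (∑ i, T.curvature r i • .proj i : (V → ℝ) →L[ℝ] ℝ) r := by
  have hcurv := hasFDerivAt_pi'.mp (differentiableAt_curvature h).hasFDerivAt
  have hsub : HasFDerivAt (fun x => T.curvature x ⬝ᵥ (x - r))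
      (∑ i, T.curvature r i • .proj i : (V → ℝ) →L[ℝ] ℝ) r := by
    refine (HasFDerivAt.fun_sum fun i _ => (hcurv i).mul
      ((hasFDerivAt_apply (𝕜 := ℝ) (F' := fun _ => ℝ) i r).sub_const (r i))).congr_fderiv ?_
    simp
  have hadd := (hasFDerivAt_curvature_dotProduct_self h).add hsub
  rw [zero_add] at hadd
  exact hadd.congr_of_eventuallyEq (.of_forall fun x => by simp [dotProduct_sub])

theorem hasFDerivAt_crg [Nonempty V] (h : r ∈ T.ballPackings) :
    HasFDerivAt T.crg
      ((∑ i, r i)⁻¹ • ∑ i, (T.curvature r i - T.crg r) • .proj i : (V → ℝ) →L[ℝ] ℝ) r := by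
  have hpos := (sum_pos_of_mem_ballPackings h).ne'
  have hsum : HasFDerivAt (fun x : V → ℝ => ∑ i, x i) (∑ i, .proj i : (V → ℝ) →L[ℝ] ℝ) r :=
    HasFDerivAt.fun_sum fun i _ => hasFDerivAt_apply (𝕜 := ℝ) (F' := fun _ => ℝ) i r
  refine ((hasFDerivAt_curvature_dotProduct h).mul
    ((hasDerivAt_inv hpos).comp_hasFDerivAt r hsum)).congr_fderiv ?_
  ext v
  simp only [dotProduct, neg_smul, smul_neg, Function.comp_apply, _root_.add_apply,
    _root_.neg_apply, _root_.smul_apply, _root_.sum_apply, ContinuousLinearMap.proj_apply,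
    smul_eq_mul, crg, sub_mul, Finset.sum_sub_distrib, ← Finset.mul_sum]
  field_simp
  ring

theorem hasFDerivAt_crg_zero_iff [Nonempty V] (h : r ∈ T.ballPackings) :
    HasFDerivAt T.crg (0 : (V → ℝ) →L[ℝ] ℝ) r ↔ ∀ i, T.curvature r i = T.crg r := by
  classical
  constructor
  · intro hcrit i
    have hgrad := congrArg (fun f : (V → ℝ) →L[ℝ] ℝ => f (Pi.single i 1))
      ((hasFDerivAt_crg h).unique hcrit)
    have hpos := (sum_pos_of_mem_ballPackings h).ne'
    simpa [Pi.single_apply, hpos, sub_eq_zero] using hgrad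
  · intro hconst
    simpa [hconst] using hasFDerivAt_crg h

lemma hasConstantCurvature_iff [Nonempty V] (h : r ∈ T.ballPackings) :
    T.HasConstantCurvature r ↔ ∀ i, T.curvature r i = T.crg r := by
  refine ⟨fun ⟨c, hc⟩ i => ?_, fun hconst => ⟨_, hconst⟩⟩
  simp only [crg, hc, ← Finset.mul_sum]
  exact (mul_div_cancel_right₀ c (sum_pos_of_mem_ballPackings h).ne').symm

/-- Monotonicity between `r'` and the rescaled packing `s • r`, in the limit `s → 0`. -/
theorem isMinOn_of_hasConstantCurvature [Nonempty V] (h : r ∈ T.ballPackings)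
    (hconst : T.HasConstantCurvature r) : IsMinOn T.crg T.ballPackings r := by
  intro r' h'
  rw [mem_ofPred_eq]
  set K := T.curvature r' - T.curvature r with hK
  have hmono : ∀ s > 0, 0 ≤ K ⬝ᵥ r' - s * K ⬝ᵥ r := fun s hs => by
    have := curvature_sub_dotProduct_sub_nonneg (smul_mem_ballPackings h hs) h'
    rwa [curvature_smul h hs, dotProduct_sub, dotProduct_smul] at this
  have hlim : Tendsto (fun s => K ⬝ᵥ r' - s * K ⬝ᵥ r) (𝓝[>] 0) (𝓝 (K ⬝ᵥ r')) := by
    have hcont : Continuous fun s => K ⬝ᵥ r' - s * K ⬝ᵥ r := by fun_prop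
    simpa using (hcont.tendsto 0).mono_left nhdsWithin_le_nhds
  have hnonneg : 0 ≤ K ⬝ᵥ r' := ge_of_tendsto hlim (eventually_mem_nhdsWithin.mono hmono)
  rw [hK, sub_dotProduct, sub_nonneg, dotProduct] at hnonneg
  simp only [(hasConstantCurvature_iff h).mp hconst, ← Finset.mul_sum] at hnonneg
  exact (le_div_iff₀ (sum_pos_of_mem_ballPackings h')).mpr hnonneg

variable (T) in
lemma bddBelow_crg [Nonempty V] : BddBelow (T.crg '' T.ballPackings) := by
  classical
  set S := (volume : Measure E3).toSphere.real univ
  refine ⟨4 * Real.pi - T.tets.card * S, forall_mem_image.mpr fun r h => ?_⟩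
  rw [crg, le_div_iff₀ (sum_pos_of_mem_ballPackings h), Finset.mul_sum]
  refine Finset.sum_le_sum fun i _ => mul_le_mul_of_nonneg_right (sub_le_sub_left ?_ _) (h.1 i).le
  refine (Finset.sum_le_card_nsmul _ _ _ fun τ _ => solidAngle_le τ r i).trans ?_
  rw [nsmul_eq_mul]
  gcongr
  exact Finset.filter_subset _ _

lemma crg_eq_yamabeInvariant_iff [Nonempty V] (h : r ∈ T.ballPackings) :
    T.crg r = T.yamabeInvariant ↔ IsMinOn T.crg T.ballPackings r := by
  constructor
  · intro heq r' h'
    exact heq.trans_le (csInf_le T.bddBelow_crg (mem_image_of_mem _ h'))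
  · intro hmin
    have hleast : IsLeast (T.crg '' T.ballPackings) (T.crg r) :=
      ⟨mem_image_of_mem _ h, forall_mem_image.mpr hmin⟩
    exact hleast.csInf_eq.symm

theorem tfae_of_mem_ballPackings [Nonempty V] (h : r ∈ T.ballPackings) :
    List.TFAE [T.HasConstantCurvature r, T.crg r = T.yamabeInvariant,
      IsMinOn T.crg T.ballPackings r, IsLocalMinOn T.crg T.ballPackings r,
      HasFDerivAt T.crg (0 : (V → ℝ) →L[ℝ] ℝ) r] := by
  tfae_have 1 → 3 := isMinOn_of_hasConstantCurvature h
  tfae_have 2 ↔ 3 := crg_eq_yamabeInvariant_iff h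
  tfae_have 3 → 4 := IsMinOn.localize
  tfae_have 4 → 5 := fun hmin => by
    have hgrad := hasFDerivAt_crg h
    rwa [(hmin.isLocalMin (T.isOpen_ballPackings.mem_nhds h)).hasFDerivAt_eq_zero hgrad] at hgrad
  tfae_have 5 ↔ 1 := (hasFDerivAt_crg_zero_iff h).trans (hasConstantCurvature_iff h).symm
  tfae_finish

theorem isMinOn_iff_exists_eq_smul [ConnectedSpace M] (h : r ∈ T.ballPackings)
    (hmin : IsMinOn T.crg T.ballPackings r) :
    (r' ∈ T.ballPackings ∧ IsMinOn T.crg T.ballPackings r') ↔ ∃ c : ℝ, 0 < c ∧ r' = c • r := by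
  have := T.nonempty_vertices
  have hK : ∀ {x}, x ∈ T.ballPackings → IsMinOn T.crg T.ballPackings x →
      T.curvature x = fun _ => T.yamabeInvariant := fun {x} hx hxmin => funext fun i => by
    rw [(hasConstantCurvature_iff hx).mp (((tfae_of_mem_ballPackings hx).out 0 2).mpr hxmin),
      (crg_eq_yamabeInvariant_iff hx).mpr hxmin]
  constructor
  · rintro ⟨h', hmin'⟩
    exact exists_eq_smul_of_curvature_eq h h' ((hK h' hmin').trans (hK h hmin).symm)
  · rintro ⟨c, hc, rfl⟩
    have h' := smul_mem_ballPackings h hc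
    have hconst : T.HasConstantCurvature (c • r) :=
      ⟨T.yamabeInvariant, fun i => by rw [curvature_smul h hc, hK h hmin]⟩
    exact ⟨h', isMinOn_of_hasConstantCurvature h' hconst⟩

end Triangulation

theorem theorem1p1_general {M : Type*} [TopologicalSpace M] [ConnectedSpace M]
    {V : Type*} [Fintype V] (T : Triangulation M V) :
    (T.ballPackings.Nonempty ∧ BddBelow (T.crg '' T.ballPackings)) ∧
    List.TFAE [
      ∃ r ∈ T.ballPackings, T.HasConstantCurvature r,
      ∃ r ∈ T.ballPackings, T.crg r = T.yamabeInvariant,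
      ∃ r ∈ T.ballPackings, IsMinOn T.crg T.ballPackings r,
      ∃ r ∈ T.ballPackings, IsLocalMinOn T.crg T.ballPackings r,
      ∃ r ∈ T.ballPackings, HasFDerivAt T.crg (0 : (V → ℝ) →L[ℝ] ℝ) r] ∧
    ∀ r₀ ∈ T.ballPackings, T.HasConstantCurvature r₀ →
      T.crg r₀ = T.yamabeInvariant ∧
      ∀ r : V → ℝ, (r ∈ T.ballPackings ∧ IsMinOn T.crg T.ballPackings r) ↔
        ∃ c : ℝ, 0 < c ∧ r = c • r₀ := by
  have := T.nonempty_vertices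
  have htfae := fun r (h : r ∈ T.ballPackings) => Triangulation.tfae_of_mem_ballPackings h
  refine ⟨⟨⟨1, T.one_mem_ballPackings⟩, T.bddBelow_crg⟩, ?_, fun r₀ h₀ hconst => ?_⟩
  · tfae_have 1 ↔ 2 := exists_congr fun r => and_congr_right fun h => (htfae r h).out 0 1
    tfae_have 2 ↔ 3 := exists_congr fun r => and_congr_right fun h => (htfae r h).out 1 2
    tfae_have 3 ↔ 4 := exists_congr fun r => and_congr_right fun h => (htfae r h).out 2 3
    tfae_have 4 ↔ 5 := exists_congr fun r => and_congr_right fun h => (htfae r h).out 3 4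
    tfae_finish
  · have hmin := ((htfae r₀ h₀).out 0 2).mp hconst
    exact ⟨((htfae r₀ h₀).out 0 1).mp hconst, fun r =>
      Triangulation.isMinOn_iff_exists_eq_smul h₀ hmin⟩

end

/-- The first conjunct says that the infimum defining the combinatorial Yamabe invariant is
finite. -/
theorem theorem1p1 {M : Type*} [TopologicalSpace M] [T2Space M] [CompactSpace M]
    [ConnectedSpace M] [ChartedSpace (EuclideanSpace ℝ (Fin 3)) M]
    {V : Type*} [Fintype V] (T : Triangulation M V) :
    (T.ballPackings.Nonempty ∧ BddBelow (T.crg '' T.ballPackings)) ∧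
    List.TFAE [
      ∃ r ∈ T.ballPackings, T.HasConstantCurvature r,
      ∃ r ∈ T.ballPackings, T.crg r = T.yamabeInvariant,
      ∃ r ∈ T.ballPackings, IsMinOn T.crg T.ballPackings r,
      ∃ r ∈ T.ballPackings, IsLocalMinOn T.crg T.ballPackings r,
      ∃ r ∈ T.ballPackings, HasFDerivAt T.crg (0 : (V → ℝ) →L[ℝ] ℝ) r] ∧
    ∀ r₀ ∈ T.ballPackings, T.HasConstantCurvature r₀ →
      T.crg r₀ = T.yamabeInvariant ∧
      ∀ r : V → ℝ, (r ∈ T.ballPackings ∧ IsMinOn T.crg T.ballPackings r) ↔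
        ∃ c : ℝ, 0 < c ∧ r = c • r₀ :=
  theorem1p1_general T
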